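/- Let $\mathcal{M}$ be a unitary magma: a set with a binary operation $\star$ having a two-sided unit $\mathds{1}$ (not necessarily associative, $\mathcal{M}$ possibly infinite). A noncrossing $\mathcal{M}$-clique of arity $n \ge 1$ is a polygon with vertices $1, \dots, n+1$ in which each arc $(x,y)$, $1 \le x < y \le n+1$, has a label in $\mathcal{M}$ and no two solid arcs (arcs with a label $\neq \mathds{1}$) cross; in arity $1$ only the clique with label $\mathds{1}$, called the unit, is allowed. The arc $(1,n+1)$ is the base, the arcs $(i,i+1)$ are the edges, the other arcs are the diagonals; for a clique $\mathfrak p$ of arity $n =: |\mathfrak p|$, $\mathfrak p_0$ is the label of its base and $\mathfrak p_i$ the label of its $i$th edge. An $\mathcal{M}$-bubble is a clique with no solid diagonal. For $\mathfrak p$ of arity $n$, $\mathfrak q$ of arity $m$ and $1 \le i \le n$, the clique $\mathfrak p \circ_i \mathfrak q$ of arity $n+m-1$ is obtained by gluing the base of $\mathfrak q$ onto the $i$th edge of $\mathfrak p$, the common arc being labelled by $\mathfrak p_i \star \mathfrak q_0$; the new arcs, which come neither from $\mathfrak p$ nor from $\mathfrak q$, are labelled by $\mathds 1$. The operad $\mathrm{NC}\mathcal{M}$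 is the linear span of the noncrossing $\mathcal{M}$-cliques over a field of characteristic zero, graded by arity, with the bilinear extensions of the $\circ_i$ as partial compositions. Let $G$ be a finite set of $\mathcal{M}$-bubbles, $B$ the set of labels of the bases and $E$ the set of labels of the edges of the elements of $G$. Assume that $\mathcal{M}$ is $(E,B)$-quasi-injective: for all $x, x' \in E$ and $y, y' \in B$, $x \star y = x' \star y' \neq \mathds{1}$ implies $x = x'$ and $y = y'$. Let $\mathcal{B}^G_{\mathcal{M}}$ be the set of $\mathcal{M}$-bubbles that can be obtained by partial compositions of elements of $G$ and, for $x \in \mathcal{M}$, define the series in noncommuting variables $\xi_y$, $y \in \mathcal{M}$, $$\mathrm{B}_x := \sum_{\substack{\mathfrak p \in \mathcal{B}^G_{\mathcal{M}},\ \mathfrak p_0 = x \\ \mathfrak p \text{ not the unit}}} \xi_{\mathfrak p_1} \xi_{\mathfrak p_2} \cdots \xi_{\mathfrak p_{|\mathfrak p|}} .$$ Then the system $$\mathrm{F}_x(t) = \mathrm{B}_x\big( (\xi_y := t + \bar{\mathrm{F}}_y(t))_{y \in \mathcal{M}} \big), \qquad \bar{\mathrm{F}}_x(t) = \sum_{\substack{y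 \in \mathcal{M} \\ x \star y \neq \mathds{1}}} \mathrm{F}_y(t) \qquad (x \in \mathcal{M})$$ has exactly one solution $(\mathrm{F}_x)_{x \in \mathcal{M}}$ consisting of formal power series in $t$ with coefficients in $\mathbb{N}$ and without constant term (all the sums that occur being locally finite, that is, finite in each degree). The components of the suboperad $(\mathrm{NC}\mathcal{M})^G$ of $\mathrm{NC}\mathcal{M}$ generated by $G$ are finite-dimensional, and its Hilbert series $\mathcal{H}(t) = \sum_{n \ge 1} \dim (\mathrm{NC}\mathcal{M})^G(n)\, t^n$ satisfies $$\mathcal{H}(t) = t + \sum_{x \in \mathcal{M}} \mathrm{F}_x(t),$$ where the sum on the right is locally finite. -/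

import Mathlib

open scoped PowerSeries

namespace NCM

/-- A noncrossing `M`-clique of arity `n ≥ 1`: a labelling by `M` of the arcs `(x, y)`,
`0 ≤ x < y ≤ n`, of a polygon with `n + 1` vertices (here numbered `0, …, n`), such that no two
solid arcs (arcs whose label is not `1`) cross. The labelling is extended by `1` to the pairs that
are not arcs. The only clique of arity `1` has its unique arc labelled by `1`. -/
@[ext]
structure NCClique (M : Type*) [MulOneClass M] (n : ℕ) where
  label : ℕ → ℕ → M
  arity_pos : 1 ≤ n
  label_off : ∀ x y, ¬ (x < y ∧ y ≤ n) → label x y = 1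
  label_arity_one : n = 1 → label 0 1 = 1
  noncrossing : ∀ x z y w, x < z → z < y → y < w → label x y = 1 ∨ label z w = 1

namespace NCClique

variable {M : Type*} [MulOneClass M] {n m : ℕ}

/-- The label of the base, that is the arc joining the first and the last vertices. -/
def base (p : NCClique M n) : M := p.label 0 n

/-- The label of the `i`th edge (`i` starts from `0`). -/
def edge (p : NCClique M n) (i : Fin n) : M := p.label i (i + 1)

/-- The border: the word of the labels of the edges, from the first one to the last one. -/
def border (p : NCClique M n) : List M := List.ofFn p.edge

/-- A bubble has no solid diagonal; a diagonal is an arc which is neither an edge nor the base. -/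
def IsBubble (p : NCClique M n) : Prop :=
  ∀ x y, x < y → y ≤ n → y ≠ x + 1 → ¬ (x = 0 ∧ y = n) → p.label x y = 1

/-- The unique clique of arity `1`. -/
def unit (M : Type*) [MulOneClass M] : NCClique M 1 where
  label _ _ := 1
  arity_pos := le_rfl
  label_off _ _ _ := rfl
  label_arity_one _ := rfl
  noncrossing _ _ _ _ _ _ _ := Or.inl rfl

/-- The labelling of `p ∘ᵢ q`: the base of `q` is glued onto the `i`th edge of `p`. The vertices
of `q` become `i, …, i + m`; the vertices `v ≤ i` of `p` are kept, and the vertices `v ≥ i + 1`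
of `p` become `v + m - 1`. The common arc is labelled by the product of the two labels. -/
def compLabel (p : NCClique M n) (i : Fin n) (q : NCClique M m) (x y : ℕ) : M :=
  if x = i ∧ y = i + m then p.edge i * q.base
  else if (i : ℕ) ≤ x ∧ y ≤ i + m then q.label (x - i) (y - i)
  else if (x ≤ i ∨ i + m ≤ x) ∧ (y ≤ i ∨ i + m ≤ y) then
    p.label (if x ≤ i then x else x + 1 - m) (if y ≤ i then y else y + 1 - m)
  else 1

/-- The partial composition `p ∘ᵢ q`. -/
def comp (p : NCClique M n) (i : Fin n) (q : NCClique M m) : NCClique M (n + m - 1) where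
  label := compLabel p i q
  arity_pos := by
    have := p.arity_pos
    have := q.arity_pos
    omega
  label_off x y h := by
    have hp := p.arity_pos
    have hq := q.arity_pos
    have hi := i.isLt
    unfold compLabel
    split_ifs <;> first
      | rfl
      | (exfalso; omega)
      | (apply q.label_off; omega)
      | (apply p.label_off; omega)
  label_arity_one h := by
    have hp := p.arity_pos
    have hq := q.arity_pos
    have hi := i.isLt
    obtain rfl : n = 1 := by omega
    obtain rfl : m = 1 := by omega
    simp [compLabel, edge, base, p.label_arity_one rfl, q.label_arity_one rfl]
  noncrossing x z y w h1 h2 h3 := by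
    have hp := p.arity_pos
    have hq := q.arity_pos
    have hi := i.isLt
    unfold compLabel
    split_ifs <;> first
      | exact Or.inl rfl
      | exact Or.inr rfl
      | (exfalso; omega)
      | (apply q.noncrossing <;> omega)
      | (apply p.noncrossing <;> omega)

end NCClique

variable {M : Type*} [MulOneClass M]

/-- The component of arity `n` of the noncrossing clique operad `NC M`: the `K`-linear span of the
noncrossing `M`-cliques of arity `n`. -/
abbrev Space (K : Type*) [Field K] (M : Type*) [MulOneClass M] (n : ℕ) : Type _ :=
  NCClique M n →₀ K

/-- The partial composition of `NC M`, the bilinear extension of the one of cliques. -/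
noncomputable def lcomp (K : Type*) [Field K] {n m : ℕ} (i : Fin n) :
    Space K M n →ₗ[K] Space K M m →ₗ[K] Space K M (n + m - 1) :=
  Finsupp.linearCombination K fun p => Finsupp.lmapDomain K K fun q => p.comp i q

theorem lcomp_single (K : Type*) [Field K] {n m : ℕ} (i : Fin n) (p : NCClique M n)
    (q : NCClique M m) (a b : K) :
    lcomp K i (Finsupp.single p a) (Finsupp.single q b) = Finsupp.single (p.comp i q) (a * b) := by
  simp [lcomp, Finsupp.linearCombination_single, Finsupp.mapDomain_single]

/-- A suboperad of `NC M`: a family of subspaces which contains the unit and is closed under all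
partial compositions. -/
structure Suboperad (K : Type*) [Field K] (M : Type*) [MulOneClass M] where
  space : ∀ n, Submodule K (Space K M n)
  unit_mem : Finsupp.single (NCClique.unit M) 1 ∈ space 1
  comp_mem : ∀ {n m : ℕ} (i : Fin n) (f : Space K M n) (g : Space K M m),
    f ∈ space n → g ∈ space m → lcomp K i f g ∈ space (n + m - 1)

/-- The suboperad of `NC M` generated by a set `G` of cliques: the smallest one that contains `G`
(its component of arity `n` is the intersection of those of all suboperads containing `G`). -/
noncomputable def generated (K : Type*) [Field K] (G : Set (Σ n, NCClique M n)) : Suboperad K M where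
  space n := ⨅ S : {S : Suboperad K M // ∀ g ∈ G, Finsupp.single g.2 1 ∈ S.space g.1},
    S.1.space n
  unit_mem := Submodule.mem_iInf _ |>.2 fun S => S.1.unit_mem
  comp_mem i f g hf hg := Submodule.mem_iInf _ |>.2 fun S =>
    S.1.comp_mem i f g (Submodule.mem_iInf _ |>.1 hf S) (Submodule.mem_iInf _ |>.1 hg S)

/-- The Hilbert series of a suboperad with finite-dimensional components. -/
noncomputable def Suboperad.hilbertSeries {K : Type*} [Field K] (S : Suboperad K M) : ℕ⟦X⟧ :=
  PowerSeries.mk fun n => Module.finrank K (S.space n)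

/-- The labels of the bases of the elements of `G`. -/
def baseLabels (G : Set (Σ n, NCClique M n)) : Set M := {b | ∃ g ∈ G, g.2.base = b}

/-- The labels of the edges of the elements of `G`. -/
def edgeLabels (G : Set (Σ n, NCClique M n)) : Set M := {e | ∃ g ∈ G, ∃ i, g.2.edge i = e}

/-- `M` is `(E, B)`-quasi-injective. -/
def QuasiInjective (E B : Set M) : Prop :=
  ∀ x ∈ E, ∀ x' ∈ E, ∀ y ∈ B, ∀ y' ∈ B, x * y = x' * y' → x * y ≠ 1 → x = x' ∧ y = y'

/-- The cliques that can be obtained by partial compositions of elements of `G`. -/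
inductive Obtained (G : Set (Σ n, NCClique M n)) : ∀ {n : ℕ}, NCClique M n → Prop
  | gen {n : ℕ} (p : NCClique M n) : ⟨n, p⟩ ∈ G → Obtained G p
  | comp {n m : ℕ} (p : NCClique M n) (i : Fin n) (q : NCClique M m) :
      Obtained G p → Obtained G q → Obtained G (p.comp i q)

/-- The noncommutative bubble series `B_x`, as the function sending a word `u` on `M` to the
coefficient of the monomial `ξ_{u₁} ⋯ ξ_{uₖ}`: the number of bubbles different from the unit, with
base labelled by `x` and border `u`, that are obtained by partial compositions of elements
of `G`. -/
noncomputable def bubbleSeries (G : Set (Σ n, NCClique M n)) (x : M) (u : List M) : ℕ :=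
  {p : Σ n, NCClique M n | Obtained G p.2 ∧ p.2.IsBubble ∧ p ≠ ⟨1, NCClique.unit M⟩ ∧
    p.2.base = x ∧ p.2.border = u}.ncard

/-- `S` is the sum of the family `f` of formal power series: for every `n`, only finitely many
members of the family have a nonzero coefficient of degree `n`, and these coefficients sum up to
the one of `S`. -/
def HasFormalSum {ι : Type*} (f : ι → ℕ⟦X⟧) (S : ℕ⟦X⟧) : Prop :=
  ∀ n, {i | PowerSeries.coeff n (f i) ≠ 0}.Finite ∧
    PowerSeries.coeff n S = ∑ᶠ i, PowerSeries.coeff n (f i)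

/-- `S` is the result of substituting the series `s y` for the variables `ξ_y` in the
noncommutative series with coefficients `f`. -/
def IsSubst (f : List M → ℕ) (s : M → ℕ⟦X⟧) (S : ℕ⟦X⟧) : Prop :=
  HasFormalSum (fun u : List M => f u • (u.map s).prod) S

/-- `F` is a solution of the system `F_x = B_x(t + F̄_{x₀}, t + F̄_{x₁}, …)`, where `F̄_x` is the sum
of the `F_y` such that `x ⋆ y ≠ 1`. The series `F_x` have no constant term, as required for the
substitution into a formal power series. -/
def IsSolution (G : Set (Σ n, NCClique M n)) (F : M → ℕ⟦X⟧) : Prop :=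
  (∀ x, PowerSeries.constantCoeff (F x) = 0) ∧
    ∃ Fbar : M → ℕ⟦X⟧,
      (∀ x, HasFormalSum (fun y : {y : M // x * y ≠ 1} => F y) (Fbar x)) ∧
      (∀ x, IsSubst (bubbleSeries G x) (fun y => PowerSeries.X + Fbar y) (F x))

end NCM

/-! A composition of cliques is a clique, so the generated suboperad has as basis the unit and the
cliques obtained from `G`; the theorem therefore counts cliques.

Every nontrivial obtained clique is, in exactly one way, an obtained bubble with base `x` and border
`a₁ … aₖ`, on whose `i`th edge is glued either the unit or a nontrivial obtained clique `qᵢ` such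
that the product of `aᵢ` and the base of `qᵢ` differs from `1`. Existence (`exists_decomposition`)
is proved by induction on compositions: a clique glued inside a nontrivial block only changes that
block, and one glued on a bare edge `a` becomes a new block or, if the common arc gets the label
`1`, has its own decomposition spliced into the row. For uniqueness (`rowLabel_injective`), the
solid arcs above nontrivial blocks show where the blocks end, and quasi-injectivity recovers both
factors of their labels; it applies because edge and base labels of nontrivial obtained cliques stay
in `E` and `B` (`Obtained.labels`).

The choices on an edge `a` have generating series `t + F̄_a`, the unit giving `t`. Counting
decompositions by the border of their bubble thus turns the bijection into the system
(`cliqueSeries_isSolution`). The solution is unique because nontrivial bubbles have arity at least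
`2`: each coefficient is determined by those of lower degree (`IsSolution.unique`). -/

namespace NCM

variable {M : Type*} [MulOneClass M]

/-! ### Cliques of all arities and the unit laws -/

/-- The type of all noncrossing cliques, of any arity. -/
abbrev Clique (M : Type*) [MulOneClass M] : Type _ := Σ n, NCClique M n

/-- The clique of arity `1`, as an element of the type of all cliques. -/
def unitClique (M : Type*) [MulOneClass M] : Clique M := ⟨1, NCClique.unit M⟩

theorem clique_ext {p q : Clique M} (h : p.1 = q.1)
    (hl : ∀ x y, x < y → y ≤ p.1 → p.2.label x y = q.2.label x y) : p = q := by
  obtain ⟨n, p⟩ := p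
  obtain ⟨m, q⟩ := q
  obtain rfl : n = m := h
  congr 1
  ext x y
  by_cases hxy : x < y ∧ y ≤ n
  · exact hl x y hxy.1 hxy.2
  · rw [p.label_off x y hxy, q.label_off x y hxy]

theorem eq_unitClique {p : Clique M} (h : p.1 = 1) : p = unitClique M := by
  refine clique_ext h fun x y hx hy => ?_
  obtain rfl : x = 0 := by omega
  obtain rfl : y = 1 := by omega
  exact p.2.label_arity_one h

theorem two_le_arity {p : Clique M} (h : p ≠ unitClique M) : 2 ≤ p.1 := by
  have h1 := p.2.arity_pos
  have h2 : p.1 ≠ 1 := fun h' => h (eq_unitClique h')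
  omega

theorem ne_unitClique {p : Clique M} (h : 2 ≤ p.1) : p ≠ unitClique M := by
  rintro rfl
  exact absurd h (by simp [unitClique])

/-- The partial composition on the type of all cliques. -/
def cliqueComp (p : Clique M) (i : Fin p.1) (q : Clique M) : Clique M :=
  ⟨p.1 + q.1 - 1, p.2.comp i q.2⟩

theorem unitClique_comp (i : Fin (unitClique M).1) (q : Clique M) :
    cliqueComp (unitClique M) i q = q := by
  have hi : (i : ℕ) = 0 := by have : (i : ℕ) < 1 := i.isLt; omega
  refine clique_ext (by simp [cliqueComp, unitClique]) fun x y hx hy => ?_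
  have hy' : y ≤ q.1 := by simpa [cliqueComp, unitClique] using hy
  simp only [cliqueComp, NCClique.comp, NCClique.compLabel, hi, zero_add, zero_le, true_and, hy',
    if_true, Nat.sub_zero]
  split_ifs with h
  · simp [h, NCClique.edge, unitClique, NCClique.unit, NCClique.base]
  · rfl

theorem comp_unitClique (p : Clique M) (i : Fin p.1) : cliqueComp p i (unitClique M) = p := by
  have hi := i.isLt
  refine clique_ext (by simp [cliqueComp, unitClique]) fun x y hx hy => ?_
  simp only [cliqueComp, NCClique.comp, NCClique.compLabel, unitClique]
  split_ifs with h1 h2 h3 h4 h5 h6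
  · simp [h1.1, h1.2, NCClique.edge, NCClique.unit, NCClique.base]
  all_goals first | rfl | (exfalso; omega)

theorem base_cliqueComp {p : Clique M} (hp : 2 ≤ p.1) (i : Fin p.1) (q : Clique M) :
    (cliqueComp p i q).2.base = p.2.base := by
  have hi := i.isLt
  have hq := q.2.arity_pos
  simp only [cliqueComp, NCClique.comp, NCClique.compLabel, NCClique.base]
  split_ifs with h1 h2 h3 h4 h5 h6
  all_goals first | rfl | (exfalso; omega) | (congr 1; omega)

/-! ### Rows of cliques and their grafts on a bubble -/

/-- The sum of the arities of the cliques in a list of pairs of a label and a clique. -/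
def weight (l : List (M × Clique M)) : ℕ := (l.map fun b => b.2.1).sum

@[simp] theorem weight_nil : weight ([] : List (M × Clique M)) = 0 := rfl

@[simp] theorem weight_cons (b : M × Clique M) (l : List (M × Clique M)) :
    weight (b :: l) = b.2.1 + weight l := by simp [weight]

@[simp] theorem weight_append (l l' : List (M × Clique M)) :
    weight (l ++ l') = weight l + weight l' := by
  simp [weight]

theorem length_le_weight (l : List (M × Clique M)) : l.length ≤ weight l := by
  induction l with
  | nil => simp
  | cons b l ih =>
    have := b.2.2.arity_pos
    simp only [List.length_cons, weight_cons]
    omega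

theorem weight_map_unit (u : List M) : weight (u.map fun a => (a, unitClique M)) = u.length := by
  simp [weight, unitClique, Function.comp_def]

/-- The labelling obtained by putting the cliques of a list side by side, the label of the base of
each of them being multiplied on the left by the label it is paired with. -/
def rowLabel : List (M × Clique M) → ℕ → ℕ → M
  | [], _, _ => 1
  | b :: l, x, y =>
    if y ≤ b.2.1 then if x = 0 ∧ y = b.2.1 then b.1 * b.2.2.base else b.2.2.label x y
    else if b.2.1 ≤ x then rowLabel l (x - b.2.1) (y - b.2.1) else 1

theorem rowLabel_cons (a : M) (q : Clique M) (l : List (M × Clique M)) (x y : ℕ) :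
    rowLabel ((a, q) :: l) x y =
      if y ≤ q.1 then if x = 0 ∧ y = q.1 then a * q.2.base else q.2.label x y
      else if q.1 ≤ x then rowLabel l (x - q.1) (y - q.1) else 1 := rfl

theorem rowLabel_off (l : List (M × Clique M)) :
    ∀ x y, ¬ (x < y ∧ y ≤ weight l) → rowLabel l x y = 1 := by
  induction l with
  | nil => intros; rfl
  | cons b l ih =>
    intro x y h
    have := b.2.2.arity_pos
    rw [weight_cons] at h
    rw [rowLabel]
    split_ifs with h1 h2 h3
    · omega
    · exact b.2.2.label_off _ _ (by omega)
    · exact ih _ _ (by omega)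
    · rfl

theorem rowLabel_append (l l' : List (M × Clique M)) : ∀ x y,
    rowLabel (l ++ l') x y = if y ≤ weight l then rowLabel l x y
      else if weight l ≤ x then rowLabel l' (x - weight l) (y - weight l) else 1 := by
  induction l with
  | nil =>
    intro x y
    simp only [List.nil_append, weight_nil, Nat.sub_zero, zero_le, if_true]
    split_ifs with h
    · rw [rowLabel_off _ _ _ (by omega), rowLabel]
    · rfl
  | cons b l ih =>
    intro x y
    obtain ⟨a, q⟩ := b
    have := q.2.arity_pos
    rw [List.cons_append, weight_cons, rowLabel_cons, rowLabel_cons, ih, ← Nat.sub_sub,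
      ← Nat.sub_sub]
    dsimp only
    split_ifs <;> first
      | rfl
      | (exfalso; omega)

theorem rowLabel_noncrossing (l : List (M × Clique M)) :
    ∀ x z y w, x < z → z < y → y < w → rowLabel l x y = 1 ∨ rowLabel l z w = 1 := by
  induction l with
  | nil => intros; exact Or.inl rfl
  | cons b l ih =>
    intro x z y w h1 h2 h3
    simp only [rowLabel]
    split_ifs <;> first
      | exact Or.inl rfl
      | exact Or.inr rfl
      | (exfalso; omega)
      | (apply ih <;> omega)
      | (apply b.2.2.noncrossing <;> omega)

/-- The clique with base labelled by `x` obtained by gluing the cliques of the list on the edges of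
the bubble with border the list of labels. -/
def graft (x : M) (l : List (M × Clique M)) (h : 2 ≤ l.length) : Clique M :=
  ⟨weight l,
    { label := fun u v => if u = 0 ∧ v = weight l then x else rowLabel l u v
      arity_pos := by have := length_le_weight l; omega
      label_off := fun u v huv => by
        have := length_le_weight l
        rw [if_neg (by omega), rowLabel_off _ _ _ huv]
      label_arity_one := fun h1 => by have := length_le_weight l; omega
      noncrossing := fun u z v w h1 h2 h3 => by
        split_ifs with h4 h5 h5
        · omega
        · exact Or.inr (rowLabel_off _ _ _ (by omega))
        · omega
        · exact rowLabel_noncrossing l _ _ _ _ h1 h2 h3 }⟩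

theorem graft_label (x : M) (l : List (M × Clique M)) (h : 2 ≤ l.length) (u v : ℕ) :
    (graft x l h).2.label u v = if u = 0 ∧ v = weight l then x else rowLabel l u v := rfl

theorem graft_arity (x : M) (l : List (M × Clique M)) (h : 2 ≤ l.length) :
    (graft x l h).1 = weight l := rfl

theorem two_le_graft_arity (x : M) (l : List (M × Clique M)) (h : 2 ≤ l.length) :
    2 ≤ (graft x l h).1 := h.trans (length_le_weight l)

theorem graft_base (x : M) (l : List (M × Clique M)) (h : 2 ≤ l.length) :
    (graft x l h).2.base = x := by
  rw [NCClique.base, graft_label, if_pos ⟨rfl, rfl⟩]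

theorem graft_congr {x x' : M} {l l' : List (M × Clique M)} (hx : x = x') (hl : l = l')
    (h : 2 ≤ l.length) : graft x l h = graft x' l' (hl ▸ h) := by
  subst hx hl
  rfl

theorem weight_append_pos {l₁ l₂ : List (M × Clique M)} {b : M × Clique M}
    (h : 2 ≤ (l₁ ++ b :: l₂).length) : 1 ≤ weight l₁ + weight l₂ := by
  have := length_le_weight l₁
  have := length_le_weight l₂
  simp only [List.length_append, List.length_cons] at h
  omega

theorem rowLabel_append_cons (l₁ l₂ : List (M × Clique M)) (a : M) (q : Clique M) (u v : ℕ)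
    (huv : u < v) :
    rowLabel (l₁ ++ (a, q) :: l₂) u v =
      if v ≤ weight l₁ then rowLabel l₁ u v
      else if weight l₁ + q.1 ≤ u then
        rowLabel l₂ (u - (weight l₁ + q.1)) (v - (weight l₁ + q.1))
      else if weight l₁ ≤ u ∧ v ≤ weight l₁ + q.1 then
        if u = weight l₁ ∧ v = weight l₁ + q.1 then a * q.2.base
        else q.2.label (u - weight l₁) (v - weight l₁)
      else 1 := by
  have hq := q.2.arity_pos
  rw [rowLabel_append, rowLabel_cons, ← Nat.sub_sub, ← Nat.sub_sub]
  split_ifs <;> first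
    | rfl
    | (exfalso; omega)

theorem rowLabel_zero_weight (l : List (M × Clique M)) (h : 2 ≤ l.length) :
    rowLabel l 0 (weight l) = 1 := by
  match l, h with
  | b :: c :: l, _ =>
    have := b.2.2.arity_pos
    have := c.2.2.arity_pos
    rw [rowLabel, weight_cons, weight_cons, if_neg (by omega), if_neg (by omega)]

section

variable (x a : M) (l₁ l₂ : List (M × Clique M)) (q : Clique M)
  (h : 2 ≤ (l₁ ++ (a, q) :: l₂).length)

theorem graft_label_inner {u v : ℕ} (huv : u < v) (hu : weight l₁ ≤ u)
    (hv : v ≤ weight l₁ + q.1) :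
    (graft x (l₁ ++ (a, q) :: l₂) h).2.label u v =
      if u = weight l₁ ∧ v = weight l₁ + q.1 then a * q.2.base
      else q.2.label (u - weight l₁) (v - weight l₁) := by
  have hw := weight_append_pos h
  rw [graft_label, rowLabel_append_cons _ _ _ _ _ _ huv, weight_append, weight_cons]
  dsimp only
  rw [if_neg (by omega), if_neg (by omega), if_neg (by omega), if_pos ⟨hu, hv⟩]

theorem graft_label_cross {u v : ℕ}
    (huv : u < weight l₁ ∧ weight l₁ < v ∧ v < weight l₁ + q.1 ∨
      weight l₁ < u ∧ u < weight l₁ + q.1 ∧ weight l₁ + q.1 < v) :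
    (graft x (l₁ ++ (a, q) :: l₂) h).2.label u v = 1 := by
  rw [graft_label, rowLabel_append_cons _ _ _ _ _ _ (by omega), weight_append, weight_cons]
  dsimp only
  rw [if_neg (by omega), if_neg (by omega), if_neg (by omega), if_neg (by omega)]

/-- Arcs that avoid the interior of a block do not see its content: replacing `q` by `q'` only
shifts the vertices to its right. This compares a graft with the one obtained by composing inside a
block. -/
theorem graft_label_outer (q' : Clique M) (h' : 2 ≤ (l₁ ++ (a, q') :: l₂).length) {u v : ℕ}
    (huv : u < v) (hu : u ≤ weight l₁ ∨ weight l₁ + q.1 ≤ u)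
    (hv : v ≤ weight l₁ ∨ weight l₁ + q.1 ≤ v) (hne : ¬ (u = weight l₁ ∧ v = weight l₁ + q.1)) :
    (graft x (l₁ ++ (a, q) :: l₂) h).2.label u v =
      (graft x (l₁ ++ (a, q') :: l₂) h').2.label (if u ≤ weight l₁ then u else u - q.1 + q'.1)
        (if v ≤ weight l₁ then v else v - q.1 + q'.1) := by
  have hq := q.2.arity_pos
  have hq' := q'.2.arity_pos
  rw [graft_label, graft_label, rowLabel_append_cons _ _ _ _ _ _ huv,
    rowLabel_append_cons _ _ _ _ _ _ (by split_ifs <;> omega), weight_append, weight_cons,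
    weight_append, weight_cons]
  dsimp only
  by_cases h2 : v ≤ weight l₁
  · have h1 : u ≤ weight l₁ := by omega
    rw [if_pos h2, if_neg (by omega), if_pos h2, if_pos h1, if_neg (by omega), if_pos h2]
  rw [if_neg h2, if_neg h2]
  by_cases h1 : u ≤ weight l₁
  · rw [if_pos h1, if_neg (show ¬ _ ≤ u by omega), if_neg (show ¬ (weight l₁ ≤ u ∧ _) by omega),
      if_neg (show ¬ _ ≤ weight l₁ by omega), if_neg (show ¬ _ ≤ u by omega),
      if_neg (show ¬ (weight l₁ ≤ u ∧ _) by omega)]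
    split_ifs <;> first
      | rfl
      | (exfalso; omega)
  · rw [if_neg h1, if_neg (by omega), if_pos (by omega), if_neg (by omega), if_neg (by omega),
      if_pos (by omega)]
    congr 1 <;> omega

end

/-- Composing inside a block of a graft. -/
theorem graft_comp (x a : M) (l₁ l₂ : List (M × Clique M)) (q q' : Clique M) (i : Fin q.1)
    (h : 2 ≤ (l₁ ++ (a, q) :: l₂).length) (h' : 2 ≤ (l₁ ++ (a, cliqueComp q i q') :: l₂).length)
    (j : Fin (graft x (l₁ ++ (a, q) :: l₂) h).1) (hj : (j : ℕ) = weight l₁ + i) :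
    cliqueComp (graft x (l₁ ++ (a, q) :: l₂) h) j q' =
      graft x (l₁ ++ (a, cliqueComp q i q') :: l₂) h' := by
  have hi := i.isLt
  have hq := q.2.arity_pos
  have hq' := q'.2.arity_pos
  have hw := weight_append_pos h
  have e1 : (cliqueComp q i q').1 = q.1 + q'.1 - 1 := rfl
  have e2 : (cliqueComp q i q').2.label = NCClique.compLabel q.2 i q'.2 := rfl
  refine clique_ext ?_ fun u v huv hv => ?_
  · change weight (l₁ ++ (a, q) :: l₂) + q'.1 - 1 = weight (l₁ ++ (a, cliqueComp q i q') :: l₂)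
    simp only [weight_append, weight_cons, e1]
    omega
  change v ≤ weight (l₁ ++ (a, q) :: l₂) + q'.1 - 1 at hv
  simp only [weight_append, weight_cons] at hv
  change NCClique.compLabel _ j _ u v = _
  rw [NCClique.compLabel, hj]
  by_cases hin : weight l₁ ≤ u ∧ v ≤ weight l₁ + (q.1 + q'.1 - 1)
  · rw [graft_label_inner _ _ _ _ _ _ huv hin.1 hin.2, e2]
    by_cases h1 : u = weight l₁ + i ∧ v = weight l₁ + i + q'.1
    · rw [if_pos h1, NCClique.edge, hj, graft_label_inner _ _ _ _ _ _ (by omega) (by omega) (by omega)]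
      by_cases hn : q.1 = 1
      · have hcc : cliqueComp q i q' = q' := by
          obtain rfl := eq_unitClique hn
          exact unitClique_comp i q'
        have hb : q.2.base = 1 := by
          obtain rfl := eq_unitClique hn
          rfl
        rw [if_pos (by omega), if_pos (by omega), hb, hcc, mul_one]
      · rw [if_neg (by omega), if_neg (by omega), NCClique.compLabel, if_pos (by omega)]
        congr 2 <;> omega
    · rw [if_neg h1]
      by_cases h2 : weight l₁ + i ≤ u ∧ v ≤ weight l₁ + i + q'.1
      · rw [if_pos h2, if_neg (by omega), NCClique.compLabel, if_neg (by omega), if_pos (by omega)]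
        congr 1 <;> omega
      · rw [if_neg h2]
        by_cases h3 : (u ≤ weight l₁ + i ∨ weight l₁ + i + q'.1 ≤ u) ∧
          (v ≤ weight l₁ + i ∨ weight l₁ + i + q'.1 ≤ v)
        · rw [if_pos h3, graft_label_inner _ _ _ _ _ _ (by split_ifs <;> omega)
            (by split_ifs <;> omega) (by split_ifs <;> omega)]
          rw [base_cliqueComp (by omega)]
          by_cases h4 : u = weight l₁ ∧ v = weight l₁ + (cliqueComp q i q').1
          · rw [if_pos h4, if_pos (by split_ifs <;> omega)]
          · rw [if_neg h4, if_neg (by split_ifs <;> omega)]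
            symm
            rw [NCClique.compLabel, if_neg (by omega), if_neg (by omega), if_pos (by omega)]
            congr 1 <;> split_ifs <;> omega
        · rw [if_neg h3, if_neg (by omega), NCClique.compLabel, if_neg (by omega),
            if_neg (by omega), if_neg (by omega)]
  · rw [if_neg (by omega), if_neg (by omega)]
    by_cases hc : u < weight l₁ ∧ weight l₁ < v ∧ v < weight l₁ + (q.1 + q'.1 - 1) ∨
      weight l₁ < u ∧ u < weight l₁ + (q.1 + q'.1 - 1) ∧ weight l₁ + (q.1 + q'.1 - 1) < v
    · rw [graft_label_cross x a l₁ l₂ (cliqueComp q i q') h' hc]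
      split_ifs <;> first
        | rfl
        | exact graft_label_cross _ _ _ _ _ _ (by omega)
    · rw [graft_label_outer _ _ _ _ _ _ q h huv (by omega) (by omega) (by omega), if_pos (by omega),
        e1]
      congr 1 <;> split_ifs <;> omega

/-- A block whose base gets the label `1` can be spliced. -/
theorem graft_splice (x a y : M) (hay : a * y = 1) (l₁ l l₂ : List (M × Clique M))
    (hl : 2 ≤ l.length) (h : 2 ≤ (l₁ ++ (a, graft y l hl) :: l₂).length)
    (h' : 2 ≤ (l₁ ++ (l ++ l₂)).length) :
    graft x (l₁ ++ (a, graft y l hl) :: l₂) h = graft x (l₁ ++ (l ++ l₂)) h' := by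
  have hw := weight_append_pos h
  have hl' := length_le_weight l
  refine clique_ext ?_ fun u v huv hv => ?_
  · simp [graft_arity]
  have hv' : v ≤ weight l₁ + (weight l + weight l₂) := by
    simpa only [graft_arity, weight_append, weight_cons] using hv
  rw [graft_label x (l₁ ++ (l ++ l₂)), rowLabel_append, rowLabel_append, weight_append,
    weight_append]
  by_cases hin : weight l₁ ≤ u ∧ v ≤ weight l₁ + weight l
  · rw [graft_label_inner _ _ _ _ _ _ huv hin.1 hin.2, graft_base, hay, graft_label, graft_arity,
      if_neg (show ¬ (u = 0 ∧ v = _ + (_ + _)) by omega), if_neg (show ¬ v ≤ weight l₁ by omega),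
      if_pos hin.1, if_pos (show v - weight l₁ ≤ weight l by omega)]
    split_ifs with h1 h2
    -- The arc above the block carries `a * y = 1`; after splicing it spans at least two blocks of
    -- the row, so it is again labelled by `1`.
    · rw [h1.1, h1.2, Nat.sub_self, Nat.add_sub_cancel_left, rowLabel_zero_weight l hl]
    · omega
    · rfl
  · rw [graft_label, rowLabel_append_cons _ _ _ _ _ _ huv, weight_append, weight_cons,
      ← Nat.sub_sub, ← Nat.sub_sub]
    dsimp only
    have e := graft_arity y l hl
    split_ifs <;> first
      | rfl
      | (exfalso; omega)

/-! ### Bubbles as grafts of units -/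

/-- The list of units indexed by a word of labels; grafting it gives a bubble. -/
def units (u : List M) : List (M × Clique M) := u.map fun a => (a, unitClique M)

theorem length_units (u : List M) : (units u).length = u.length := by simp [units]

theorem weight_units (u : List M) : weight (units u) = u.length := weight_map_unit u

theorem rowLabel_units (u : List M) :
    ∀ i j, rowLabel (units u) i j = if j = i + 1 then u[i]?.getD 1 else 1 := by
  induction u with
  | nil => intro i j; simp [units, rowLabel]
  | cons a u ih =>
    intro i j
    rw [units, List.map_cons, ← units, rowLabel_cons, ih]
    change (if j ≤ 1 then if i = 0 ∧ j = 1 then _ else _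
      else if 1 ≤ i then if j - 1 = i - 1 + 1 then u[i - 1]?.getD 1 else 1 else 1) = _
    by_cases h1 : j ≤ 1
    · rw [if_pos h1]
      by_cases h2 : i = 0 ∧ j = 1
      · obtain ⟨rfl, rfl⟩ := h2
        simp [unitClique, NCClique.unit, NCClique.base]
      · rw [if_neg h2, if_neg (by omega)]
        rfl
    · rw [if_neg h1]
      by_cases h2 : 1 ≤ i
      · obtain ⟨i, rfl⟩ : ∃ k, i = k + 1 := ⟨i - 1, by omega⟩
        rw [if_pos h2, Nat.add_sub_cancel, List.getElem?_cons_succ]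
        congr 1
        simp only [eq_iff_iff]
        omega
      · rw [if_neg h2, if_neg (by omega)]

/-- The bubble with base labelled by `x` and border `u`. -/
def bubble (x : M) (u : List M) (h : 2 ≤ u.length) : Clique M :=
  graft x (units u) (by rwa [length_units])

theorem bubble_arity (x : M) (u : List M) (h : 2 ≤ u.length) : (bubble x u h).1 = u.length :=
  weight_units u

theorem bubble_label (x : M) (u : List M) (h : 2 ≤ u.length) (i j : ℕ) :
    (bubble x u h).2.label i j =
      if i = 0 ∧ j = u.length then x else if j = i + 1 then u[i]?.getD 1 else 1 := by
  rw [bubble, graft_label, weight_units, rowLabel_units]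

theorem bubble_base (x : M) (u : List M) (h : 2 ≤ u.length) : (bubble x u h).2.base = x :=
  graft_base _ _ _

theorem bubble_edge (x : M) (u : List M) (h : 2 ≤ u.length) (i : Fin (bubble x u h).1)
    (hi : (i : ℕ) < u.length) : (bubble x u h).2.edge i = u[(i : ℕ)] := by
  rw [NCClique.edge, bubble_label, if_neg (by omega), if_pos rfl, List.getElem?_eq_getElem hi,
    Option.getD_some]

theorem bubble_border (x : M) (u : List M) (h : 2 ≤ u.length) : (bubble x u h).2.border = u := by
  refine List.ext_getElem ?_ fun i h1 h2 => ?_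
  · simp [NCClique.border, bubble_arity]
  · simp only [NCClique.border, List.getElem_ofFn]
    exact bubble_edge x u h _ h2

theorem bubble_isBubble (x : M) (u : List M) (h : 2 ≤ u.length) :
    (bubble x u h).2.IsBubble := by
  intro i j _ _ h1 h2
  rw [bubble_arity] at h2
  rw [bubble_label, if_neg h2, if_neg h1]

theorem length_border (p : Clique M) : p.2.border.length = p.1 := by
  simp [NCClique.border]

theorem eq_bubble {p : Clique M} (hp : p.2.IsBubble) (h : 2 ≤ p.1) :
    p = bubble p.2.base p.2.border (by rwa [length_border]) := by
  refine clique_ext ?_ fun i j hij hj => ?_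
  · rw [bubble_arity, length_border]
  rw [bubble_label, length_border]
  split_ifs with h1 h2
  · rw [h1.1, h1.2, NCClique.base]
  · have hi : i < p.2.border.length := by rw [length_border]; omega
    rw [List.getElem?_eq_getElem hi, Option.getD_some, h2]
    simp [NCClique.border, NCClique.edge]
  · exact hp i j hij hj h2 h1

/-! ### Existence of the decomposition of an obtained clique -/

section Obtained

variable (G : Set (Clique M))

/-- The nontrivial cliques obtained by partial compositions of elements of `G`. -/
def Nontriv (p : Clique M) : Prop := Obtained G p.2 ∧ p ≠ unitClique M

/-- The pairs of a label `a` and a clique `q` that can occur in the decomposition of a nontrivial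
clique. -/
def Allowed (a : M) (q : Clique M) : Prop :=
  q = unitClique M ∨ Nontriv G q ∧ a * q.2.base ≠ 1

/-- The bubble with base `x` and border `u` exists and is obtained from `G`. -/
def ObtainedBubble (x : M) (u : List M) : Prop :=
  ∃ h : 2 ≤ u.length, Obtained G (bubble x u h).2

/-- The lists of which the graft is a decomposition of a nontrivial clique. -/
def Decomposition (x : M) (l : List (M × Clique M)) : Prop :=
  ObtainedBubble G x (l.map Prod.fst) ∧ ∀ b ∈ l, Allowed G b.1 b.2

variable {G}

theorem Obtained.comp_clique {p q : Clique M} (hp : Obtained G p.2) (hq : Obtained G q.2)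
    (i : Fin p.1) : Obtained G (cliqueComp p i q).2 := Obtained.comp p.2 i q.2 hp hq

theorem Decomposition.two_le_length {x : M} {l : List (M × Clique M)} (h : Decomposition G x l) :
    2 ≤ l.length := by
  obtain ⟨⟨h, -⟩, -⟩ := h
  rwa [List.length_map] at h

/-- The blocks are composed onto the bubble from left to right: `l₁` holds those already in place,
and the next one is composed at edge `weight l₁`, where a unit block stands. -/
theorem obtained_graft_append (x : M) (l₂ : List (M × Clique M)) :
    ∀ (l₁ : List (M × Clique M)) (h : 2 ≤ (l₁ ++ units (l₂.map Prod.fst)).length)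
      (h' : 2 ≤ (l₁ ++ l₂).length), (∀ b ∈ l₂, Allowed G b.1 b.2) →
      Obtained G (graft x (l₁ ++ units (l₂.map Prod.fst)) h).2 →
      Obtained G (graft x (l₁ ++ l₂) h').2 := by
  induction l₂ with
  | nil => intro l₁ h h' _ h1; exact h1
  | cons b l₂ ih =>
    intro l₁ h h' hb h1
    obtain ⟨a, q⟩ := b
    have key : ∀ h2, Obtained G (graft x (l₁ ++ (a, q) :: units (l₂.map Prod.fst)) h2).2 := by
      intro h2
      rcases hb (a, q) List.mem_cons_self with hq | ⟨⟨hq, -⟩, -⟩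
      · obtain rfl : q = unitClique M := hq
        exact h1
      · let i : Fin (unitClique M).1 := ⟨0, Nat.one_pos⟩
        have e : cliqueComp (unitClique M) i q = q := unitClique_comp i q
        have hw : weight l₁ < (graft x (l₁ ++ units (((a, q) :: l₂).map Prod.fst)) h).1 := by
          rw [graft_arity, weight_append, weight_units]
          simp
        have := graft_comp x a l₁ (units (l₂.map Prod.fst)) (unitClique M) q i h
          (by rw [e]; exact h2) ⟨weight l₁, hw⟩ rfl
        simp only [e] at this
        rw [← this]
        exact h1.comp_clique hq _
    have h3 := ih (l₁ ++ [(a, q)]) (by simpa [units] using h) (by simpa using h')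
      (fun b hb' => hb b (List.mem_cons_of_mem _ hb'))
    have e₁ : l₁ ++ [(a, q)] ++ units (l₂.map Prod.fst) =
        l₁ ++ (a, q) :: units (l₂.map Prod.fst) := by simp
    have e₂ : l₁ ++ [(a, q)] ++ l₂ = l₁ ++ (a, q) :: l₂ := by simp
    rw [graft_congr rfl e₁, graft_congr rfl e₂] at h3
    exact h3 (key _)

theorem Decomposition.obtained {x : M} {l : List (M × Clique M)} (h : Decomposition G x l) :
    Nontriv G (graft x l h.two_le_length) := by
  refine ⟨?_, ne_unitClique (two_le_graft_arity _ _ _)⟩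
  obtain ⟨⟨h1, h2⟩, h3⟩ := h
  exact obtained_graft_append x l [] _ _ h3 h2

theorem exists_split (l : List (M × Clique M)) : ∀ j < weight l,
    ∃ l₁ b l₂ i, l = l₁ ++ b :: l₂ ∧ j = weight l₁ + i ∧ i < b.2.1 := by
  induction l with
  | nil => intro j hj; simp at hj
  | cons b l ih =>
    intro j hj
    rw [weight_cons] at hj
    by_cases h : j < b.2.1
    · exact ⟨[], b, l, j, rfl, by simp, h⟩
    · obtain ⟨l₁, c, l₂, i, rfl, h1, h2⟩ := ih (j - b.2.1) (by omega)
      exact ⟨b :: l₁, c, l₂, i, rfl, by rw [weight_cons]; omega, h2⟩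

/-- When the common arc gets the label `1`, the composite of two bubbles has no solid diagonal and
is again a bubble: `graft_comp` followed by `graft_splice`. -/
theorem ObtainedBubble.splice {x a y : M} {u₁ u u₂ : List M}
    (h : ObtainedBubble G x (u₁ ++ a :: u₂)) (h' : ObtainedBubble G y u) (hay : a * y = 1) :
    ObtainedBubble G x (u₁ ++ (u ++ u₂)) := by
  obtain ⟨h1, h2⟩ := h
  obtain ⟨h3, h4⟩ := h'
  have h5 : 2 ≤ (u₁ ++ (u ++ u₂)).length := by
    simp only [List.length_append]
    omega
  refine ⟨h5, ?_⟩
  let i : Fin (unitClique M).1 := ⟨0, Nat.one_pos⟩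
  have e : cliqueComp (unitClique M) i (bubble y u h3) = bubble y u h3 := unitClique_comp i _
  have hu : units (u₁ ++ a :: u₂) = units u₁ ++ (a, unitClique M) :: units u₂ := by simp [units]
  have hu' : units (u₁ ++ (u ++ u₂)) = units u₁ ++ (units u ++ units u₂) := by simp [units]
  have l1 : 2 ≤ (units u₁ ++ (a, unitClique M) :: units u₂).length := by
    rw [← hu, length_units]; exact h1
  have e1 : bubble x (u₁ ++ a :: u₂) h1 = graft x (units u₁ ++ (a, unitClique M) :: units u₂) l1 :=
    graft_congr rfl hu _
  have e2 : bubble x (u₁ ++ (u ++ u₂)) h5 = graft x (units u₁ ++ (units u ++ units u₂))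
      (by rw [← hu', length_units]; exact h5) := graft_congr rfl hu' _
  have hw : weight (units u₁) <
      (graft x (units u₁ ++ (a, unitClique M) :: units u₂) l1).1 := by
    rw [graft_arity, weight_append, weight_cons]
    have : (unitClique M).1 = 1 := rfl
    simp [this]
  have l2 : 2 ≤ (units u₁ ++ (a, bubble y u h3) :: units u₂).length := by
    simpa using l1
  have := graft_comp x a (units u₁) (units u₂) (unitClique M) (bubble y u h3) i l1
    (by rw [e]; exact l2) ⟨weight (units u₁), hw⟩ rfl
  simp only [e] at this
  have h6 := graft_splice x a y hay (units u₁) (units u) (units u₂) (by rwa [length_units]) l2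
    (by rw [← hu', length_units]; exact h5)
  rw [e2, ← h6]
  change Obtained G (graft x (units u₁ ++ (a, bubble y u h3) :: units u₂) l2).2
  rw [← this]
  rw [e1] at h2
  exact h2.comp_clique h4 _

/-- The edge `j` lies in a block `(a, q)`. If `q` is the unit, the second clique is spliced in or
becomes a block, according to whether `a * y = 1`; otherwise the composition takes place inside `q`.
-/
theorem Decomposition.comp {x y : M} {l l' : List (M × Clique M)} (hl : Decomposition G x l)
    (hl' : Decomposition G y l') (j : Fin (graft x l hl.two_le_length).1) :
    ∃ (l'' : List (M × Clique M)) (h : Decomposition G x l''),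
      cliqueComp (graft x l hl.two_le_length) j (graft y l' hl'.two_le_length) =
        graft x l'' h.two_le_length := by
  obtain ⟨l₁, ⟨a, q⟩, l₂, i, rfl, hj, hi⟩ := exists_split l j j.isLt
  have hq := hl.2 (a, q) (by simp)
  have e := graft_comp x a l₁ l₂ q (graft y l' hl'.two_le_length) ⟨i, hi⟩ hl.two_le_length
    (by simpa using hl.two_le_length) j hj
  have hmem : ∀ b ∈ l₁ ++ l₂, Allowed G b.1 b.2 := fun b hb => hl.2 b (by
    simp only [List.mem_append, List.mem_cons] at hb ⊢
    tauto)
  have hN := hl'.obtained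
  have main : ∀ q', Allowed G a q' → Decomposition G x (l₁ ++ (a, q') :: l₂) := by
    intro q' hq'
    refine ⟨by simpa using hl.1, fun b hb => ?_⟩
    simp only [List.mem_append, List.mem_cons] at hb
    rcases hb with hb | rfl | hb
    · exact hmem b (by simp [hb])
    · exact hq'
    · exact hmem b (by simp [hb])
  rcases hq with hq | ⟨⟨hq1, hq2⟩, hq3⟩
  · obtain rfl : q = unitClique M := hq
    have e' : cliqueComp (unitClique M) ⟨i, hi⟩ (graft y l' hl'.two_le_length) =
      graft y l' hl'.two_le_length := unitClique_comp _ _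
    simp only [e'] at e
    by_cases hay : a * y = 1
    · refine ⟨l₁ ++ (l' ++ l₂), ⟨?_, ?_⟩, ?_⟩
      · have := hl.1
        simp only [List.map_append, List.map_cons] at this ⊢
        exact this.splice hl'.1 hay
      · intro b hb
        simp only [List.mem_append] at hb
        rcases hb with hb | hb | hb
        · exact hmem b (by simp [hb])
        · exact hl'.2 b hb
        · exact hmem b (by simp [hb])
      · rw [e]
        exact graft_splice x a y hay _ _ _ _ _ _
    · exact ⟨_, main (graft y l' hl'.two_le_length) (Or.inr ⟨hN, by rwa [graft_base]⟩), e⟩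
  -- Composing inside a nontrivial block preserves its base, so the arc above it stays solid.
  · have h2 : 2 ≤ q.1 := two_le_arity hq2
    have h1 := (graft y l' hl'.two_le_length).2.arity_pos
    refine ⟨_, main _ (Or.inr ⟨⟨hq1.comp_clique hN.1 _, ?_⟩, ?_⟩), e⟩
    · refine ne_unitClique ?_
      change 2 ≤ q.1 + _ - 1
      omega
    · rwa [base_cliqueComp h2]

-- Induction on `Obtained` with arity and clique bundled, so that the unit laws are usable as plain
-- equalities.
@[elab_as_elim]
theorem Obtained.clique_induction {P : Clique M → Prop} (hgen : ∀ g ∈ G, P g)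
    (hcomp : ∀ (p q : Clique M) (i : Fin p.1), Obtained G p.2 → Obtained G q.2 → P p → P q →
      P (cliqueComp p i q)) (p : Clique M) (hp : Obtained G p.2) : P p := by
  obtain ⟨n, p⟩ := p
  change Obtained G p at hp
  induction hp with
  | gen p hp => exact hgen _ hp
  | comp p i q hp hq ihp ihq => exact hcomp ⟨_, p⟩ ⟨_, q⟩ i hp hq ihp ihq

theorem exists_decomposition (hbubble : ∀ g ∈ G, g.2.IsBubble) {p : Clique M}
    (hp : Obtained G p.2) : p = unitClique M ∨
      ∃ x l, ∃ h : Decomposition G x l, p = graft x l h.two_le_length := by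
  refine Obtained.clique_induction (fun p hp => ?_) (fun p q i hp hq ihp ihq => ?_) p hp
  · by_cases hu : p = unitClique M
    · exact Or.inl hu
    · have e := eq_bubble (hbubble _ hp) (two_le_arity hu)
      have hf : (units p.2.border).map Prod.fst = p.2.border := by simp [units, Function.comp_def]
      refine Or.inr ⟨p.2.base, units p.2.border, ⟨?_, ?_⟩, e⟩
      · rw [hf]
        exact ⟨by rw [length_border]; exact two_le_arity hu, by rw [← e]; exact .gen _ hp⟩
      · intro b hb
        obtain ⟨a, -, rfl⟩ := List.mem_map.1 hb
        exact Or.inl rfl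
  · rcases ihp with rfl | ⟨x, l, hl, rfl⟩
    · rwa [unitClique_comp]
    · rcases ihq with rfl | ⟨y, l', hl', rfl⟩
      · rw [comp_unitClique]
        exact Or.inr ⟨x, l, hl, rfl⟩
      · exact Or.inr ⟨x, hl.comp hl' i⟩

/-! ### Labels of obtained cliques: finiteness and uniqueness of the decomposition -/

/-- The labels of the arcs of the obtained cliques. -/
def arcLabels (G : Set (Clique M)) : Set M :=
  insert 1 (edgeLabels G ∪ baseLabels G ∪ Set.image2 (· * ·) (edgeLabels G) (baseLabels G))

/-- Composing two nontrivial cliques makes the common arc a diagonal. Edges and base therefore keep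
labels coming from `G`, and a product is always of an element of `E` by one of `B`: products are
never iterated, which keeps the label set finite. -/
theorem Obtained.labels (hbubble : ∀ g ∈ G, g.2.IsBubble) {p : Clique M} (hp : Obtained G p.2) :
    p = unitClique M ∨ (∀ i < p.1, p.2.label i (i + 1) ∈ edgeLabels G) ∧
      p.2.base ∈ baseLabels G ∧ ∀ i j, p.2.label i j ∈ arcLabels G := by
  refine Obtained.clique_induction (fun p hp => Or.inr ?_) (fun p q i _ _ ihp ihq => ?_) p hp
  · have hE : ∀ i < p.1, p.2.label i (i + 1) ∈ edgeLabels G :=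
      fun i hi => ⟨p, hp, ⟨i, hi⟩, rfl⟩
    have hB : p.2.base ∈ baseLabels G := ⟨p, hp, rfl⟩
    refine ⟨hE, hB, fun i j => ?_⟩
    by_cases hij : i < j ∧ j ≤ p.1
    · by_cases h0 : i = 0 ∧ j = p.1
      · obtain ⟨rfl, rfl⟩ := h0
        exact Or.inr (Or.inl (Or.inr hB))
      · by_cases h1 : j = i + 1
        · subst h1
          exact Or.inr (Or.inl (Or.inl (hE i (by omega))))
        · exact Or.inl (hbubble p hp i j hij.1 hij.2 h1 h0)
    · exact Or.inl (p.2.label_off i j hij)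
  · by_cases hpu : p = unitClique M
    · subst hpu
      rwa [unitClique_comp]
    by_cases hqu : q = unitClique M
    · subst hqu
      rwa [comp_unitClique]
    obtain ⟨hpE, hpB, hpL⟩ := ihp.resolve_left hpu
    obtain ⟨hqE, hqB, hqL⟩ := ihq.resolve_left hqu
    have hp2 := two_le_arity hpu
    have hq2 := two_le_arity hqu
    have hi := i.isLt
    have e1 : (cliqueComp p i q).1 = p.1 + q.1 - 1 := rfl
    have e2 : (cliqueComp p i q).2.label = NCClique.compLabel p.2 i q.2 := rfl
    refine Or.inr ⟨fun k hk => ?_, ?_, fun k j => ?_⟩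
    · rw [e1] at hk
      -- The common arc spans `q.1 ≥ 2` edges, so it is not an edge itself.
      rw [e2, NCClique.compLabel, if_neg (by omega)]
      by_cases h2 : (i : ℕ) ≤ k ∧ k + 1 ≤ i + q.1
      · rw [if_pos h2, show k + 1 - (i : ℕ) = k - i + 1 by omega]
        exact hqE _ (by omega)
      · rw [if_neg h2, if_pos (by omega)]
        by_cases h3 : k + 1 ≤ (i : ℕ)
        · rw [if_pos (by omega), if_pos h3]
          exact hpE _ (by omega)
        · rw [if_neg (by omega), if_neg h3, show k + 1 + 1 - q.1 = k + 1 - q.1 + 1 by omega]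
          exact hpE _ (by omega)
    · rwa [base_cliqueComp hp2]
    · rw [e2, NCClique.compLabel]
      split_ifs
      · exact Or.inr (Or.inr ⟨_, hpE i hi, _, hqB, rfl⟩)
      · exact hqL _ _
      · exact hpL _ _
      · exact hpL _ _
      · exact hpL _ _
      · exact hpL _ _
      · exact Or.inl rfl

theorem Nontriv.base_mem (hbubble : ∀ g ∈ G, g.2.IsBubble) {p : Clique M} (hp : Nontriv G p) :
    p.2.base ∈ baseLabels G := ((hp.1.labels hbubble).resolve_left hp.2).2.1

theorem ObtainedBubble.mem_edgeLabels (hbubble : ∀ g ∈ G, g.2.IsBubble) {x : M} {u : List M}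
    (h : ObtainedBubble G x u) {a : M} (ha : a ∈ u) : a ∈ edgeLabels G := by
  obtain ⟨h2, h⟩ := h
  obtain ⟨i, hi, rfl⟩ := List.getElem_of_mem ha
  have hi' : i < (bubble x u h2).1 := by rwa [bubble_arity]
  rw [← bubble_edge x u h2 ⟨i, hi'⟩ hi]
  exact ((h.labels hbubble).resolve_left (ne_unitClique (two_le_graft_arity _ _ _))).1 i hi'

theorem baseLabels_finite (hG : G.Finite) : (baseLabels G).Finite :=
  (hG.image fun g => g.2.base).subset fun _ ⟨g, hg, h⟩ => ⟨g, hg, h⟩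

theorem edgeLabels_finite (hG : G.Finite) : (edgeLabels G).Finite := by
  refine (hG.biUnion fun g _ => Set.finite_range g.2.edge).subset ?_
  rintro _ ⟨g, hg, i, rfl⟩
  exact Set.mem_biUnion hg ⟨i, rfl⟩

theorem arcLabels_finite (hG : G.Finite) : (arcLabels G).Finite :=
  (((edgeLabels_finite hG).union (baseLabels_finite hG)).union
    ((edgeLabels_finite hG).image2 _ (baseLabels_finite hG))).insert 1

theorem finite_setOf_label_mem {L : Set M} (hL : L.Finite) (n : ℕ) :
    {p : NCClique M n | ∀ i j, p.label i j ∈ L}.Finite := by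
  have := hL.to_subtype
  let f : {p : NCClique M n | ∀ i j, p.label i j ∈ L} → Fin (n + 1) → Fin (n + 1) → L :=
    fun p i j => ⟨p.1.label i j, p.2 i j⟩
  refine Set.finite_coe_iff.1 (Finite.of_injective f fun p q h => Subtype.ext ?_)
  ext i j
  by_cases hij : i < j ∧ j ≤ n
  · exact congrArg Subtype.val
      (congrFun (congrFun h ⟨i, by omega⟩) ⟨j, by omega⟩)
  · rw [p.1.label_off i j hij, q.1.label_off i j hij]

theorem finite_obtained (hG : G.Finite) (hbubble : ∀ g ∈ G, g.2.IsBubble) (n : ℕ) :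
    {p : NCClique M n | Obtained G p}.Finite := by
  refine (finite_setOf_label_mem (arcLabels_finite hG) n).subset fun p hp i j => ?_
  rcases Obtained.labels (p := ⟨n, p⟩) hbubble hp with h | h
  · have : ∀ q : Clique M, q = unitClique M → q.2.label i j = 1 := by rintro _ rfl; rfl
    exact Or.inl (this _ h)
  · exact h.2.2 i j

/-- The row is read from the left: the arity of the first block is determined, then its content, and
the remaining labels are the row of the tail. -/
theorem rowLabel_injective {E B : Set M} (hqi : QuasiInjective E B) (l : List (M × Clique M)) :
    ∀ l' : List (M × Clique M),
      (∀ b ∈ l, b.1 ∈ E ∧ (b.2 = unitClique M ∨ b.2.2.base ∈ B ∧ 2 ≤ b.2.1 ∧ b.1 * b.2.2.base ≠ 1)) →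
      (∀ b ∈ l', b.1 ∈ E ∧ (b.2 = unitClique M ∨ b.2.2.base ∈ B ∧ 2 ≤ b.2.1 ∧ b.1 * b.2.2.base ≠ 1)) →
      weight l = weight l' → rowLabel l = rowLabel l' → l = l' := by
  -- If the first block `b` were shorter than `b'`, the arc spanning `b'` would leave `b` and be
  -- labelled by `1`, whereas it is solid in the other row.
  have aux : ∀ (b b' : M × Clique M) (l l' : List (M × Clique M)),
      (b'.2 = unitClique M ∨ b'.2.2.base ∈ B ∧ 2 ≤ b'.2.1 ∧ b'.1 * b'.2.2.base ≠ 1) →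
      rowLabel (b :: l) = rowLabel (b' :: l') → b'.2.1 ≤ b.2.1 := by
    intro b b' l l' hb' h
    have hb := b.2.2.arity_pos
    by_contra! hlt
    rcases hb' with hu | ⟨-, h2, h3⟩
    · rw [hu] at hlt
      change _ < 1 at hlt
      omega
    · have := congrFun (congrFun h 0) b'.2.1
      rw [rowLabel_cons, rowLabel_cons, if_neg (by omega), if_neg (by omega), if_pos le_rfl,
        if_pos ⟨rfl, rfl⟩] at this
      exact h3 this.symm
  induction l with
  | nil =>
    intro l' _ _ hw _
    cases l' with
    | nil => rfl
    | cons b l' =>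
      have := b.2.2.arity_pos
      simp only [weight_nil, weight_cons] at hw
      omega
  | cons b l ih =>
    intro l' hl hl' hw hr
    cases l' with
    | nil =>
      have := b.2.2.arity_pos
      simp only [weight_nil, weight_cons] at hw
      omega
    | cons b' l' =>
      have hb := hl b List.mem_cons_self
      have hb' := hl' b' List.mem_cons_self
      have har : b.2.1 = b'.2.1 := le_antisymm (aux b' b _ _ hb.2 hr.symm) (aux b b' _ _ hb'.2 hr)
      have hpos := b.2.2.arity_pos
      have htail : l = l' := by
        refine ih l' (fun c hc => hl c (List.mem_cons_of_mem _ hc))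
          (fun c hc => hl' c (List.mem_cons_of_mem _ hc)) ?_ ?_
        · simp only [weight_cons] at hw
          omega
        · ext i j
          by_cases hj : 0 < j
          · have := congrFun (congrFun hr (i + b.2.1)) (j + b.2.1)
            rw [rowLabel_cons, rowLabel_cons, 
              if_neg (show ¬ j + b.2.1 ≤ b.2.1 by omega),
              if_neg (show ¬ j + b.2.1 ≤ b'.2.1 by omega),
              if_pos (show b.2.1 ≤ i + b.2.1 by omega),
              if_pos (show b'.2.1 ≤ i + b.2.1 by omega)] at this
            simpa [← har] using this
          · rw [rowLabel_off _ _ _ (by omega), rowLabel_off _ _ _ (by omega)]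
      have htop : b.1 * b.2.2.base = b'.1 * b'.2.2.base := by
        have := congrFun (congrFun hr 0) b.2.1
        rwa [rowLabel_cons, rowLabel_cons, if_pos le_rfl, if_pos ⟨rfl, rfl⟩, if_pos har.le,
          if_pos ⟨rfl, har⟩] at this
      have hhead : b.1 = b'.1 ∧ b.2 = b'.2 := by
        -- On a unit block the arc reads `a * 1`, which gives back `a` even when it is not solid;
        -- quasi-injectivity is needed only for the other blocks, whose top arc is solid.
        by_cases hu : b.2.1 = 1
        · have e := eq_unitClique hu
          have e' := eq_unitClique (har ▸ hu)
          refine ⟨?_, e.trans e'.symm⟩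
          rw [e, e'] at htop
          simpa [unitClique, NCClique.unit, NCClique.base] using htop
        · obtain ⟨h1, h2, h3⟩ := hb.2.resolve_left (fun h => hu (by rw [h]; rfl))
          obtain ⟨h1', h2', h3'⟩ := hb'.2.resolve_left (fun h => hu (by rw [har, h]; rfl))
          obtain ⟨k1, k2⟩ := hqi _ hb.1 _ hb'.1 _ h1 _ h1' htop h3
          refine ⟨k1, clique_ext har fun i j hij hj => ?_⟩
          by_cases h0 : i = 0 ∧ j = b.2.1
          · rw [h0.1, h0.2]
            exact k2.trans (congrArg (b'.2.2.label 0) har.symm)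
          · have := congrFun (congrFun hr i) j
            rwa [rowLabel_cons, rowLabel_cons, if_pos hj, if_neg h0, if_pos (har ▸ hj),
              if_neg (har ▸ h0)] at this
      rw [htail, Prod.ext hhead.1 hhead.2]

end Obtained

/-! ### The generated suboperad is spanned by cliques -/

section Generated

variable (K : Type*) [Field K] (G : Set (Clique M))

/-- The cliques of arity `n` of the suboperad generated by `G`. -/
def basisSet (n : ℕ) : Set (NCClique M n) := {p | Obtained G p ∨ n = 1}

variable {G} in
theorem mem_basisSet_comp {n m : ℕ} {p : NCClique M n} {q : NCClique M m} (i : Fin n)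
    (hp : p ∈ basisSet G n) (hq : q ∈ basisSet G m) : p.comp i q ∈ basisSet G (n + m - 1) := by
  by_cases hn : n = 1
  · subst hn
    have hp' : (⟨1, p⟩ : Clique M) = unitClique M := eq_unitClique rfl
    have hp'' : p = NCClique.unit M := eq_of_heq (Sigma.mk.inj hp').2
    subst hp''
    have e : cliqueComp (unitClique M) i ⟨m, q⟩ = ⟨m, q⟩ := unitClique_comp i _
    -- The composite has arity `1 + m - 1`, so it equals `q` only as a bundled clique; the variable
    -- `c` allows the substitution.
    have : ∀ c : Clique M, c = ⟨m, q⟩ → Obtained G c.2 ∨ c.1 = 1 := by rintro _ rfl; exact hq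
    exact this _ e
  · by_cases hm : m = 1
    · subst hm
      have hq' : (⟨1, q⟩ : Clique M) = unitClique M := eq_unitClique rfl
      have hq'' : q = NCClique.unit M := eq_of_heq (Sigma.mk.inj hq').2
      subst hq''
      have e : cliqueComp ⟨n, p⟩ i (unitClique M) = ⟨n, p⟩ := comp_unitClique ⟨n, p⟩ i
      have : ∀ c : Clique M, c = ⟨n, p⟩ → Obtained G c.2 ∨ c.1 = 1 := by rintro _ rfl; exact hp
      exact this _ e
    · exact Or.inl (.comp p i q (hp.resolve_right hn) (hq.resolve_right hm))

/-- The suboperad spanned by the unit and by the cliques obtained from `G`. -/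
noncomputable def spanSuboperad : Suboperad K M where
  space n := Finsupp.supported K K (basisSet G n)
  unit_mem := Finsupp.single_mem_supported _ _ (Or.inr rfl)
  comp_mem {n m} i f g hf hg := by
    have h : Submodule.map₂ (lcomp K i) (Finsupp.supported K K (basisSet G n))
        (Finsupp.supported K K (basisSet G m)) ≤
          Finsupp.supported K K (basisSet G (n + m - 1)) := by
      rw [Finsupp.supported_eq_span_single, Finsupp.supported_eq_span_single,
        Submodule.map₂_span_span, Submodule.span_le]
      rintro _ ⟨_, ⟨p, hp, rfl⟩, _, ⟨q, hq, rfl⟩, rfl⟩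
      simp only [lcomp_single]
      exact Finsupp.single_mem_supported _ _ (mem_basisSet_comp i hp hq)
    exact h (Submodule.apply_mem_map₂ _ hf hg)

theorem single_mem_of_obtained {S : Suboperad K M}
    (hS : ∀ g ∈ G, Finsupp.single g.2 1 ∈ S.space g.1) {n : ℕ} {p : NCClique M n}
    (hp : Obtained G p) : Finsupp.single p 1 ∈ S.space n := by
  induction hp with
  | gen p hp => exact hS _ hp
  | comp p i q _ _ ihp ihq =>
    have := S.comp_mem i _ _ ihp ihq
    rwa [lcomp_single, one_mul] at this

theorem generated_space (n : ℕ) :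
    (generated K G).space n = Finsupp.supported K K (basisSet G n) := by
  refine le_antisymm ?_ (le_iInf fun S => ?_)
  · exact iInf_le (fun S : {S : Suboperad K M // ∀ g ∈ G, Finsupp.single g.2 1 ∈ S.space g.1} =>
      S.1.space n) ⟨spanSuboperad K G, fun g hg =>
        Finsupp.single_mem_supported _ _ (Or.inl (.gen g.2 hg))⟩
  · rw [Finsupp.supported_eq_span_single, Submodule.span_le]
    rintro _ ⟨p, hp, rfl⟩
    rcases hp with hp | rfl
    · exact single_mem_of_obtained K G S.2 hp
    · have hp' : (⟨1, p⟩ : Clique M) = unitClique M := eq_unitClique rfl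
      have hp'' : p = NCClique.unit M := eq_of_heq (Sigma.mk.inj hp').2
      rw [hp'']
      exact S.1.unit_mem

variable {G}

theorem basisSet_finite (hG : G.Finite) (hbubble : ∀ g ∈ G, g.2.IsBubble) (n : ℕ) :
    (basisSet G n).Finite := by
  have h1 : {p : NCClique M n | n = 1}.Finite := by
    refine Set.Subsingleton.finite fun p hp q hq => ?_
    have : (⟨n, p⟩ : Clique M) = ⟨n, q⟩ := 
      (eq_unitClique (p := ⟨n, p⟩) hp).trans (eq_unitClique (p := ⟨n, q⟩) hq).symm
    exact eq_of_heq (Sigma.mk.inj this).2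
  exact ((finite_obtained hG hbubble n).union h1).subset fun p hp => hp

theorem generated_finite (hG : G.Finite) (hbubble : ∀ g ∈ G, g.2.IsBubble) (n : ℕ) :
    Module.Finite K ((generated K G).space n) := by
  have := (basisSet_finite hG hbubble n).to_subtype
  rw [generated_space]
  exact Module.Finite.equiv (Finsupp.supportedEquivFinsupp (M := K) (R := K) (basisSet G n)).symm

theorem finrank_generated (hG : G.Finite) (hbubble : ∀ g ∈ G, g.2.IsBubble) (n : ℕ) :
    Module.finrank K ((generated K G).space n) = (basisSet G n).ncard := by
  have := (basisSet_finite hG hbubble n).fintype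
  rw [generated_space,
    (Finsupp.supportedEquivFinsupp (M := K) (R := K) (basisSet G n)).finrank_eq,
    Module.finrank_finsupp_self, Set.ncard_eq_toFinset_card', Set.toFinset_card]

end Generated

/-! ### Generating series of weighted sets -/

section GeneratingSeries

open PowerSeries

variable {ι κ : Type*}

/-- The generating series of a set with respect to a weight. -/
noncomputable def genSeries (S : Set ι) (w : ι → ℕ) : ℕ⟦X⟧ :=
  PowerSeries.mk fun n => {i | i ∈ S ∧ w i = n}.ncard

theorem coeff_genSeries (S : Set ι) (w : ι → ℕ) (n : ℕ) :
    coeff n (genSeries S w) = {i | i ∈ S ∧ w i = n}.ncard := PowerSeries.coeff_mk _ _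

/-- A set has finitely many elements of each weight. -/
def LocallyFinite (S : Set ι) (w : ι → ℕ) : Prop := ∀ n, {i | i ∈ S ∧ w i = n}.Finite

theorem genSeries_bijOn {S : Set ι} {T : Set κ} {w : ι → ℕ} {w' : κ → ℕ} {φ : ι → κ}
    (h : Set.BijOn φ S T) (hw : ∀ i ∈ S, w' (φ i) = w i) : genSeries S w = genSeries T w' := by
  ext n
  rw [coeff_genSeries, coeff_genSeries]
  refine Set.ncard_congr (fun i _ => φ i) ?_ ?_ ?_
  · rintro i ⟨hi, rfl⟩
    exact ⟨h.mapsTo hi, hw i hi⟩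
  · rintro i j ⟨hi, -⟩ ⟨hj, -⟩ hij
    exact h.injOn hi hj hij
  · rintro k ⟨hk, rfl⟩
    obtain ⟨i, hi, rfl⟩ := h.surjOn hk
    exact ⟨i, ⟨hi, (hw i hi).symm⟩, rfl⟩

theorem LocallyFinite.mono {S T : Set ι} {w : ι → ℕ} (h : LocallyFinite T w) (hST : S ⊆ T) :
    LocallyFinite S w := fun n => (h n).subset fun _ hi => ⟨hST hi.1, hi.2⟩

/-- Sorting by the value of `f`, where `g` enumerates without repetition all the values taken. It is
applied to the base of a clique and to the border in a decomposition. -/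
theorem LocallyFinite.hasFormalSum {S : Set ι} {w : ι → ℕ} (hS : LocallyFinite S w)
    {μ : Type*} (f : ι → κ) (g : μ → κ) (hg : Function.Injective g)
    (hfg : ∀ i ∈ S, f i ∈ Set.range g) :
    HasFormalSum (fun k => genSeries {i | i ∈ S ∧ f i = g k} w) (genSeries S w) := by
  classical
  intro n
  simp only [coeff_genSeries]
  have hfin := hS n
  have hsub : ∀ k, {i | i ∈ {i | i ∈ S ∧ f i = g k} ∧ w i = n} ⊆ {i | i ∈ S ∧ w i = n} :=
    fun k i hi => ⟨hi.1.1, hi.2⟩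
  have hsupp : {k | {i | i ∈ {i | i ∈ S ∧ f i = g k} ∧ w i = n}.ncard ≠ 0}.Finite := by
    refine Set.Finite.of_finite_image ((hfin.image f).subset ?_) hg.injOn
    rintro _ ⟨k, hk, rfl⟩
    obtain ⟨i, hi⟩ := (Set.ncard_pos (hfin.subset (hsub k))).1 (Nat.pos_of_ne_zero hk)
    exact ⟨i, ⟨hi.1.1, hi.2⟩, hi.1.2⟩
  refine ⟨hsupp, ?_⟩
  rw [finsum_eq_sum_of_support_subset (s := hsupp.toFinset) _ (by intro k hk; simpa using hk),
    Set.ncard_eq_toFinset_card _ hfin]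
  rw [Finset.card_eq_sum_card_fiberwise (f := f) (t := hsupp.toFinset.image g), Finset.sum_image hg.injOn]
  · refine Finset.sum_congr rfl fun k _ => ?_
    rw [Set.ncard_eq_toFinset_card _ (hfin.subset (hsub k))]
    congr 1
    ext i
    simp only [Finset.mem_filter, Set.Finite.mem_toFinset, Set.mem_ofPred_eq]
    tauto
  · intro i hi
    have hi' : i ∈ S ∧ w i = n := by simpa using hi
    obtain ⟨k, hk⟩ := hfg i hi'.1
    simp only [Finset.coe_image, Set.Finite.coe_toFinset]
    refine ⟨k, ?_, hk⟩
    exact ((Set.ncard_pos (hfin.subset (hsub k))).2 ⟨i, ⟨hi'.1, hk.symm⟩, hi'.2⟩).ne'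

theorem LocallyFinite.prod {S : Set ι} {T : Set κ} {w : ι → ℕ} {w' : κ → ℕ}
    (hS : LocallyFinite S w) (hT : LocallyFinite T w') :
    LocallyFinite (S ×ˢ T) (fun b => w b.1 + w' b.2) := by
  intro n
  refine Set.Finite.subset (Set.Finite.biUnion (Finset.HasAntidiagonal.antidiagonal n).finite_toSet
    fun a _ => (hS a.1).prod (hT a.2)) ?_
  rintro ⟨i, k⟩ ⟨⟨hi, hk⟩, h⟩
  exact Set.mem_biUnion (x := (w i, w' k)) (by simpa using h) ⟨⟨hi, rfl⟩, ⟨hk, rfl⟩⟩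

theorem genSeries_prod {S : Set ι} {T : Set κ} {w : ι → ℕ} {w' : κ → ℕ}
    (hS : LocallyFinite S w) (hT : LocallyFinite T w') :
    genSeries (S ×ˢ T) (fun b => w b.1 + w' b.2) = genSeries S w * genSeries T w' := by
  classical
  ext n
  rw [coeff_mul, coeff_genSeries, Set.ncard_eq_toFinset_card _ (hS.prod hT n),
    Finset.card_eq_sum_card_fiberwise (f := fun b => (w b.1, w' b.2)) (t := Finset.HasAntidiagonal.antidiagonal n)]
  · refine Finset.sum_congr rfl fun a ha => ?_
    rw [coeff_genSeries, coeff_genSeries, ← Set.ncard_prod,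
      Set.ncard_eq_toFinset_card _ ((hS a.1).prod (hT a.2))]
    congr 1
    ext ⟨i, k⟩
    have := Finset.HasAntidiagonal.mem_antidiagonal.1 ha
    simp only [Finset.mem_filter, Set.Finite.mem_toFinset, Set.mem_ofPred_eq, Set.mem_prod,
      Prod.ext_iff]
    constructor
    · tauto
    · rintro ⟨⟨h1, h2⟩, h3, h4⟩
      exact ⟨⟨⟨h1, h3⟩, by omega⟩, h2, h4⟩
  · intro b hb
    have hb' : (b.1 ∈ S ∧ b.2 ∈ T) ∧ w b.1 + w' b.2 = n := by simpa using hb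
    simpa using hb'.2

/-- The lists of pairs with first components given by a word, satisfying a relation. -/
def listsOver (R : κ → ι → Prop) (u : List κ) : Set (List (κ × ι)) :=
  {l | l.map Prod.fst = u ∧ ∀ b ∈ l, R b.1 b.2}

theorem listsOver_cons_bijOn (R : κ → ι → Prop) (a : κ) (u : List κ) :
    Set.BijOn (fun b : ι × List (κ × ι) => (a, b.1) :: b.2) ({i | R a i} ×ˢ listsOver R u)
      (listsOver R (a :: u)) := by
  refine ⟨?_, ?_, ?_⟩
  · rintro ⟨i, l⟩ ⟨hi, hl, hl'⟩
    refine ⟨by simp [hl], fun b hb => ?_⟩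
    rcases List.mem_cons.1 hb with rfl | hb
    · exact hi
    · exact hl' b hb
  · rintro ⟨i, l⟩ _ ⟨i', l'⟩ _ h
    simpa using h
  · rintro l ⟨hl, hl'⟩
    match l, hl, hl' with
    | ⟨a', i⟩ :: l, hl, hl' =>
      obtain ⟨rfl, h⟩ : a' = a ∧ l.map Prod.fst = u := by simpa using hl
      exact ⟨(i, l), ⟨hl' _ List.mem_cons_self,
        h, fun b hb => hl' b (List.mem_cons_of_mem _ hb)⟩, rfl⟩

/-- The combinatorial form of substitution: choosing independently an item for each letter of `u`
multiplies the series. -/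
theorem genSeries_listsOver (R : κ → ι → Prop) (w : ι → ℕ)
    (hR : ∀ a, LocallyFinite {i | R a i} w) (u : List κ) :
    LocallyFinite (listsOver R u) (fun l => (l.map fun b => w b.2).sum) ∧
      genSeries (listsOver R u) (fun l => (l.map fun b => w b.2).sum) =
        (u.map fun a => genSeries {i | R a i} w).prod := by
  induction u with
  | nil =>
    have h0 : listsOver R [] = {[]} := by
      ext l
      simp only [listsOver, List.map_eq_nil_iff, Set.mem_ofPred_eq, Set.mem_singleton_iff]
      constructor
      · exact fun h => h.1
      · rintro rfl
        simp
    rw [h0]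
    refine ⟨fun n => (Set.finite_singleton []).subset fun l hl => hl.1, ?_⟩
    ext n
    rw [coeff_genSeries, List.map_nil, List.prod_nil, coeff_one]
    split_ifs with hn
    · subst hn
      rw [show {i : List (κ × ι) | i ∈ ({[]} : Set (List (κ × ι))) ∧
        (i.map fun b => w b.2).sum = 0} = {[]} by ext l; simp +contextual]
      simp
    · rw [show {i : List (κ × ι) | i ∈ ({[]} : Set (List (κ × ι))) ∧
        (i.map fun b => w b.2).sum = n} = ∅ by
          ext l
          simp only [Set.mem_ofPred_eq, Set.mem_singleton_iff, Set.mem_empty_iff_false, iff_false]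
          rintro ⟨rfl, h⟩
          exact hn h.symm]
      simp
  | cons a u ih =>
    have hb := listsOver_cons_bijOn R a u
    have hp := (hR a).prod ih.1
    refine ⟨fun n => ?_, ?_⟩
    · refine ((hp n).image fun b : ι × List (κ × ι) => (a, b.1) :: b.2).subset ?_
      rintro l ⟨hl, hn⟩
      obtain ⟨b, hb', rfl⟩ := hb.surjOn hl
      exact ⟨b, ⟨hb', by simpa using hn⟩, rfl⟩
    · rw [List.map_cons, List.prod_cons, ← ih.2, ← genSeries_prod (hR a) ih.1]
      exact (genSeries_bijOn hb fun _ _ => by simp).symm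

end GeneratingSeries

/-! ### Uniqueness of the solution -/

section Uniqueness

open PowerSeries

theorem hasFormalSum_coeff_congr {ι : Type*} {f f' : ι → ℕ⟦X⟧} {S S' : ℕ⟦X⟧}
    (h : HasFormalSum f S) (h' : HasFormalSum f' S') {n : ℕ}
    (hff : ∀ i, coeff n (f i) = coeff n (f' i)) : coeff n S = coeff n S' := by
  rw [(h n).2, (h' n).2]
  exact finsum_congr hff

theorem coeff_mul_congr {A A' P P' : ℕ⟦X⟧} {n : ℕ} (hA : ∀ k ≤ n, coeff k A = coeff k A')
    (hP : ∀ k ≤ n, coeff k P = coeff k P') : coeff n (A * P) = coeff n (A' * P') := by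
  rw [coeff_mul, coeff_mul]
  refine Finset.sum_congr rfl fun a ha => ?_
  have := Finset.HasAntidiagonal.mem_antidiagonal.1 ha
  rw [hA _ (by omega), hP _ (by omega)]

theorem coeff_list_prod_congr {κ : Type*} {s s' : κ → ℕ⟦X⟧} (u : List κ) : ∀ {n : ℕ},
    (∀ a, ∀ k ≤ n, coeff k (s a) = coeff k (s' a)) →
    coeff n (u.map s).prod = coeff n (u.map s').prod := by
  induction u with
  | nil => intros; rfl
  | cons a u ih =>
    intro n h
    rw [List.map_cons, List.prod_cons, List.map_cons, List.prod_cons]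
    exact coeff_mul_congr (h a) fun k hk => ih fun a j hj => h a j (hj.trans hk)

/-- The coefficient of degree `n` of a product of at least two series without constant term only
depends on the coefficients of lower degrees of its factors. -/
theorem coeff_list_prod_congr_of_lt {κ : Type*} {s s' : κ → ℕ⟦X⟧} {n : ℕ}
    (h0 : ∀ a, coeff 0 (s a) = 0) (h0' : ∀ a, coeff 0 (s' a) = 0)
    (h : ∀ a, ∀ k < n, coeff k (s a) = coeff k (s' a)) (u : List κ) (hu : 2 ≤ u.length) :
    coeff n (u.map s).prod = coeff n (u.map s').prod := by
  match u, hu with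
  | a :: b :: u, _ =>
    -- The second factor makes the tail of the product vanish in degree `0`, so no contribution
    -- involves degree `n` of the first factor; symmetrically for the tail.
    have hz : ∀ s : κ → ℕ⟦X⟧, (∀ a, coeff 0 (s a) = 0) → coeff 0 ((b :: u).map s).prod = 0 := by
      intro s hs
      rw [List.map_cons, List.prod_cons, coeff_mul, Finset.HasAntidiagonal.antidiagonal_zero,
        Finset.sum_singleton, hs b, zero_mul]
    rw [List.map_cons, List.prod_cons, List.map_cons (f := s'), List.prod_cons, coeff_mul, coeff_mul]
    refine Finset.sum_congr rfl fun c hc => ?_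
    have hc' := Finset.HasAntidiagonal.mem_antidiagonal.1 hc
    by_cases h1 : c.1 = 0
    · rw [h1, h0, h0', zero_mul, zero_mul]
    by_cases h2 : c.2 = 0
    · rw [h2, hz s h0, hz s' h0', mul_zero, mul_zero]
    rw [h _ _ (by omega), coeff_list_prod_congr (b :: u) fun a k hk => h a k (by omega)]

/-- Strong induction on the degree: only words of length at least `2` contribute, and their factors
`t + F̄_y` have no constant term. -/
theorem IsSolution.unique {G : Set (Clique M)} {F F' : M → ℕ⟦X⟧}
    (hlen : ∀ x u, bubbleSeries G x u ≠ 0 → 2 ≤ u.length)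
    (hF : IsSolution G F) (hF' : IsSolution G F') : F = F' := by
  obtain ⟨h0, Fb, hb, hs⟩ := hF
  obtain ⟨h0', Fb', hb', hs'⟩ := hF'
  have z : ∀ {F Fb : M → ℕ⟦X⟧}, (∀ x, constantCoeff (F x) = 0) →
      (∀ x, HasFormalSum (fun y : {y : M // x * y ≠ 1} => F y) (Fb x)) →
      ∀ a, coeff 0 (X + Fb a) = 0 := by
    intro F Fb h0 hb a
    rw [map_add, (hb a 0).2]
    simp [h0]
  suffices h : ∀ n x, coeff n (F x) = coeff n (F' x) by
    funext x
    ext n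
    exact h n x
  intro n
  induction n using Nat.strong_induction_on with
  | _ n ih =>
    intro x
    refine hasFormalSum_coeff_congr (hs x) (hs' x) fun u => ?_
    by_cases hu : bubbleSeries G x u = 0
    · simp [hu]
    · rw [map_nsmul, map_nsmul]
      congr 1
      refine coeff_list_prod_congr_of_lt (z h0 hb) (z h0' hb') (fun a k hk => ?_) u (hlen x u hu)
      rw [map_add, map_add, hasFormalSum_coeff_congr (hb a) (hb' a) fun y => ih k hk y]

end Uniqueness

/-! ### The clique series solve the system and give the Hilbert series -/

section Main

open PowerSeries

variable {G : Set (Clique M)}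

/-- A nontrivial bubble is determined by its base and border, so every coefficient is `0` or `1`. -/
theorem bubbleSeries_eq (x : M) (u : List M) [Decidable (ObtainedBubble G x u)] :
    bubbleSeries G x u = if ObtainedBubble G x u then 1 else 0 := by
  have key : ∀ p : Clique M, p.2.IsBubble → p ≠ unitClique M → p.2.base = x →
      p.2.border = u → ∃ h, p = bubble x u h := by
    rintro p hp hu rfl rfl
    exact ⟨by rw [length_border]; exact two_le_arity hu, eq_bubble hp (two_le_arity hu)⟩
  rw [bubbleSeries]
  split_ifs with h
  · obtain ⟨h2, h⟩ := h
    rw [Set.ncard_eq_one]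
    refine ⟨bubble x u h2, Set.ext fun p => ⟨?_, ?_⟩⟩
    · rintro ⟨-, hp, hu, hb, hbo⟩
      obtain ⟨_, rfl⟩ := key p hp hu hb hbo
      rfl
    · rintro rfl
      exact ⟨h, bubble_isBubble x u h2, ne_unitClique (two_le_graft_arity _ _ _),
        bubble_base x u h2, bubble_border x u h2⟩
  · convert Set.ncard_empty (Clique M)
    refine Set.eq_empty_of_forall_notMem ?_
    rintro p ⟨ho, hp, hu, hb, hbo⟩
    obtain ⟨h2, rfl⟩ := key p hp hu hb hbo
    exact h ⟨h2, ho⟩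

theorem two_le_length_of_bubbleSeries_ne_zero (x : M) (u : List M) (h : bubbleSeries G x u ≠ 0) :
    2 ≤ u.length := by
  classical
  rw [bubbleSeries_eq] at h
  by_contra hu
  exact h (if_neg fun ⟨h2, _⟩ => hu h2)

theorem nontriv_locallyFinite (hG : G.Finite) (hbubble : ∀ g ∈ G, g.2.IsBubble) :
    LocallyFinite {p | Nontriv G p} Sigma.fst := by
  intro n
  refine ((finite_obtained hG hbubble n).image (Sigma.mk n)).subset ?_
  rintro ⟨_, p⟩ ⟨hp, rfl⟩
  exact ⟨p, hp.1, rfl⟩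

/-- This is the series `t + F̄_a` substituted for `ξ_a`: the unit is the only clique of arity `1`,
and the other choices are nontrivial. -/
theorem genSeries_allowed (hG : G.Finite) (hbubble : ∀ g ∈ G, g.2.IsBubble) (a : M) :
    LocallyFinite {q | Allowed G a q} Sigma.fst ∧
      genSeries {q | Allowed G a q} Sigma.fst =
        X + genSeries {q | Nontriv G q ∧ a * q.2.base ≠ 1} Sigma.fst := by
  have hfin := nontriv_locallyFinite hG hbubble
  refine ⟨fun n => ?_, ?_⟩
  · refine ((hfin n).union (Set.finite_singleton (unitClique M))).subset ?_
    rintro q ⟨hq | hq, hn⟩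
    · exact Or.inr hq
    · exact Or.inl ⟨hq.1, hn⟩
  · ext n
    rw [map_add, coeff_genSeries, coeff_genSeries, coeff_X]
    split_ifs with hn
    · subst hn
      have e1 : {q | q ∈ {q | Allowed G a q} ∧ q.1 = 1} = {unitClique M} := by
        ext q
        refine ⟨fun h => eq_unitClique h.2, ?_⟩
        rintro rfl
        exact ⟨Or.inl rfl, rfl⟩
      have e2 : {q | q ∈ {q | Nontriv G q ∧ a * q.2.base ≠ 1} ∧ q.1 = 1} = ∅ :=
        Set.eq_empty_of_forall_notMem fun q h => h.1.1.2 (eq_unitClique h.2)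
      rw [e1, e2, Set.ncard_singleton, Set.ncard_empty]
    · rw [zero_add]
      congr 1
      ext q
      refine ⟨fun ⟨h, h'⟩ => ⟨?_, h'⟩, fun ⟨h, h'⟩ => ⟨Or.inr h, h'⟩⟩
      refine Or.resolve_left h ?_
      rintro rfl
      exact hn h'.symm

/-- The solution of the system: the generating series of the nontrivial cliques obtained from `G`
with a given label of the base. -/
noncomputable def cliqueSeries (G : Set (Clique M)) (x : M) : ℕ⟦X⟧ :=
  genSeries {p | Nontriv G p ∧ p.2.base = x} Sigma.fst

theorem constantCoeff_cliqueSeries (x : M) : constantCoeff (cliqueSeries G x) = 0 := by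
  rw [← coeff_zero_eq_constantCoeff_apply, cliqueSeries, coeff_genSeries]
  convert Set.ncard_empty (Clique M)
  refine Set.eq_empty_of_forall_notMem fun p h => ?_
  have := p.2.arity_pos
  have h2 : p.1 = 0 := h.2
  omega

open Classical in
/-- The graft as a total function, with the unit as a default value. -/
noncomputable def graftOrUnit (x : M) (l : List (M × Clique M)) : Clique M :=
  if h : 2 ≤ l.length then graft x l h else unitClique M

theorem graftOrUnit_eq (x : M) (l : List (M × Clique M)) (h : 2 ≤ l.length) :
    graftOrUnit x l = graft x l h := dif_pos h

theorem Decomposition.block (hbubble : ∀ g ∈ G, g.2.IsBubble) {x : M} {l : List (M × Clique M)}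
    (h : Decomposition G x l) (b : M × Clique M) (hb : b ∈ l) :
    b.1 ∈ edgeLabels G ∧ (b.2 = unitClique M ∨
      b.2.2.base ∈ baseLabels G ∧ 2 ≤ b.2.1 ∧ b.1 * b.2.2.base ≠ 1) := by
  refine ⟨h.1.mem_edgeLabels hbubble (List.mem_map_of_mem hb), ?_⟩
  exact (h.2 b hb).imp_right fun ⟨h1, h2⟩ => ⟨h1.base_mem hbubble, two_le_arity h1.2, h2⟩

theorem graft_injective {E B : Set M} (hqi : QuasiInjective E B) {x x' : M}
    {l l' : List (M × Clique M)} (h : 2 ≤ l.length) (h' : 2 ≤ l'.length)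
    (hl : ∀ b ∈ l, b.1 ∈ E ∧
      (b.2 = unitClique M ∨ b.2.2.base ∈ B ∧ 2 ≤ b.2.1 ∧ b.1 * b.2.2.base ≠ 1))
    (hl' : ∀ b ∈ l', b.1 ∈ E ∧
      (b.2 = unitClique M ∨ b.2.2.base ∈ B ∧ 2 ≤ b.2.1 ∧ b.1 * b.2.2.base ≠ 1))
    (e : graft x l h = graft x' l' h') : l = l' := by
  have hw : weight l = weight l' := congrArg Sigma.fst e
  refine rowLabel_injective hqi l l' hl hl' hw ?_
  ext i j
  -- The base of the graft hides this entry of the row, but it is `1` in any row of at least two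
  -- blocks.
  by_cases h0 : i = 0 ∧ j = weight l
  · rw [h0.1, h0.2, rowLabel_zero_weight l h, hw, rowLabel_zero_weight l' h']
  · have : (graft x l h).2.label i j = (graft x' l' h').2.label i j := by rw [e]
    rwa [graft_label, graft_label, if_neg h0, if_neg (hw ▸ h0)] at this

theorem graftOrUnit_bijOn (hbubble : ∀ g ∈ G, g.2.IsBubble)
    (hqi : QuasiInjective (edgeLabels G) (baseLabels G)) (x : M) :
    Set.BijOn (graftOrUnit x) {l | Decomposition G x l} {p | Nontriv G p ∧ p.2.base = x} := by
  refine ⟨fun l hl => ?_, fun l hl l' hl' h => ?_, fun p hp => ?_⟩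
  · rw [graftOrUnit_eq x l (Decomposition.two_le_length hl)]
    exact ⟨Decomposition.obtained hl, graft_base _ _ _⟩
  · rw [graftOrUnit_eq x l (Decomposition.two_le_length hl),
      graftOrUnit_eq x l' (Decomposition.two_le_length hl')] at h
    exact graft_injective hqi _ _ (Decomposition.block hbubble hl)
      (Decomposition.block hbubble hl') h
  · obtain ⟨hp, rfl⟩ := hp
    obtain ⟨y, l, hl, rfl⟩ := (exists_decomposition hbubble hp.1).resolve_left hp.2
    rw [graft_base]
    exact ⟨l, hl, graftOrUnit_eq _ _ _⟩

theorem cliqueSeries_isSolution (hG : G.Finite) (hbubble : ∀ g ∈ G, g.2.IsBubble)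
    (hqi : QuasiInjective (edgeLabels G) (baseLabels G)) : IsSolution G (cliqueSeries G) := by
  classical
  have hfin := nontriv_locallyFinite hG hbubble
  refine ⟨constantCoeff_cliqueSeries,
    fun a => genSeries {q | Nontriv G q ∧ a * q.2.base ≠ 1} Sigma.fst, fun a => ?_, fun x => ?_⟩
  · have h1 : LocallyFinite {q | Nontriv G q ∧ a * q.2.base ≠ 1} Sigma.fst :=
      hfin.mono fun _ h => h.1
    have h2 := h1.hasFormalSum (fun q : Clique M => q.2.base)
      (Subtype.val : {y : M // a * y ≠ 1} → M) Subtype.val_injective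
      fun q hq => ⟨⟨q.2.base, hq.2⟩, rfl⟩
    convert h2 using 2 with y
    rw [cliqueSeries]
    congr 1
    ext q
    refine ⟨fun ⟨h, h'⟩ => ⟨⟨h, ?_⟩, h'⟩, fun ⟨h, h'⟩ => ⟨h.1, h'⟩⟩
    rw [h']
    exact y.2
  · have hbij := graftOrUnit_bijOn hbubble hqi x
    have hweight : ∀ l ∈ {l | Decomposition G x l}, (graftOrUnit x l).1 = weight l := by
      intro l hl
      rw [graftOrUnit_eq x l (Decomposition.two_le_length hl), graft_arity]
    -- Grafting is injective and preserves the weight, so finiteness is inherited from the obtained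
    -- cliques.
    have hloc : LocallyFinite {l | Decomposition G x l} weight := by
      intro n
      refine Set.Finite.of_injOn (f := graftOrUnit x) ?_ (hbij.injOn.mono fun l hl => hl.1)
        (hfin n)
      rintro l ⟨hl, rfl⟩
      exact ⟨(hbij.mapsTo hl).1, hweight l hl⟩
    -- Decompositions are sorted by the border `u` of their bubble; those over `u` are all the lists
    -- of allowed blocks if the bubble is obtained, and none otherwise.
    have hsum := hloc.hasFormalSum (fun l : List (M × Clique M) => l.map Prod.fst) id
      Function.injective_id fun l _ => ⟨_, rfl⟩
    rw [genSeries_bijOn hbij hweight, ← cliqueSeries] at hsum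
    unfold IsSubst
    convert hsum using 2 with u
    rw [bubbleSeries_eq]
    have hprod := (genSeries_listsOver (Allowed G) Sigma.fst
      (fun a => (genSeries_allowed hG hbubble a).1) u).2
    simp only [fun a => (genSeries_allowed hG hbubble a).2] at hprod
    split_ifs with hu
    · rw [one_smul, ← hprod]
      change genSeries _ weight = _
      congr 1
      ext l
      refine ⟨fun ⟨h, h'⟩ => ⟨⟨by rw [h]; exact hu, h'⟩, h⟩, fun ⟨h, h'⟩ => ⟨h', h.2⟩⟩
    · rw [zero_smul]
      ext n
      rw [map_zero, coeff_genSeries, eq_comm]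
      convert Set.ncard_empty (List (M × Clique M))
      refine Set.eq_empty_of_forall_notMem fun l hl => hu ?_
      have h2 : l.map Prod.fst = u := hl.1.2
      exact h2 ▸ hl.1.1.1

theorem hilbertSeries_generated (K : Type*) [Field K] (hG : G.Finite)
    (hbubble : ∀ g ∈ G, g.2.IsBubble) :
    (generated K G).hilbertSeries = X + genSeries {p | Nontriv G p} Sigma.fst := by
  ext n
  rw [Suboperad.hilbertSeries, coeff_mk, finrank_generated K hG hbubble, map_add, coeff_X,
    coeff_genSeries]
  split_ifs with hn
  · subst hn
    have e1 : basisSet G 1 = {NCClique.unit M} := by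
      ext p
      refine ⟨fun _ => ?_, fun _ => Or.inr rfl⟩
      exact eq_of_heq (Sigma.mk.inj (eq_unitClique (p := ⟨1, p⟩) rfl)).2
    have e2 : {p | p ∈ {p | Nontriv G p} ∧ p.1 = 1} = ∅ :=
      Set.eq_empty_of_forall_notMem fun q h => h.1.2 (eq_unitClique h.2)
    rw [e1, e2, Set.ncard_singleton, Set.ncard_empty]
  · rw [zero_add]
    refine Set.ncard_congr (fun p _ => ⟨n, p⟩) ?_ ?_ ?_
    · intro p hp
      refine ⟨⟨hp.resolve_right hn, fun h => hn (congrArg Sigma.fst h)⟩, rfl⟩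
    · intro p q _ _ h
      exact eq_of_heq (Sigma.mk.inj h).2
    · rintro ⟨_, p⟩ ⟨hp, rfl⟩
      exact ⟨p, Or.inl hp.1, rfl⟩

end Main

end NCM

theorem mainTheorem12 {K : Type*} [Field K] [CharZero K] {M : Type*} [MulOneClass M]
    (G : Set (Σ n, NCM.NCClique M n)) (hfin : G.Finite) (hbubble : ∀ g ∈ G, g.2.IsBubble)
    (hqi : NCM.QuasiInjective (NCM.edgeLabels G) (NCM.baseLabels G)) :
    (∀ n, Module.Finite K ((NCM.generated K G).space n)) ∧
    (∃! F : M → ℕ⟦X⟧, NCM.IsSolution G F) ∧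
    (∀ F : M → ℕ⟦X⟧, NCM.IsSolution G F →
      ∃ S : ℕ⟦X⟧, NCM.HasFormalSum F S ∧
        (NCM.generated K G).hilbertSeries = PowerSeries.X + S) := by
  have hsol := NCM.cliqueSeries_isSolution hfin hbubble hqi
  have huniq : ∀ F : M → ℕ⟦X⟧, NCM.IsSolution G F → F = NCM.cliqueSeries G := fun F hF =>
    hF.unique NCM.two_le_length_of_bubbleSeries_ne_zero hsol
  refine ⟨NCM.generated_finite K hfin hbubble, ⟨_, hsol, huniq⟩, fun F hF => ?_⟩
  rw [huniq F hF]
  exact ⟨_, (NCM.nontriv_locallyFinite hfin hbubble).hasFormalSum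
    (fun p : NCM.Clique M => p.2.base) id Function.injective_id (fun p _ => ⟨_, rfl⟩),
    NCM.hilbertSeries_generated K hfin hbubble⟩
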